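/- Let $\psi_{j,m}$ ($j\ge 1$, $m\in\mathbb Z$) be the discrete Haar wavelets: $\psi_{j,m}=2^{-j/2}$ for $0\le m<2^{j-1}$, $\psi_{j,m}=-2^{-j/2}$ for $2^{j-1}\le m<2^j$, and $\psi_{j,m}=0$ otherwise; put $\psi_{j,k}(t)=\psi_{j,k-t}$. Let $\{X_{t,T}\}_{t=0,\dots,T-1}$, $T=2^J$, be a zero-mean Gaussian locally stationary wavelet process, that is, for each $T=2^J$ the process $(X_{t,T})_{0\le t<T}$ is Gaussian and $$X_{t,T}=\sum_{j=1}^{J}\sum_{k} w^0_{j,k;T}\,\psi_{j,k}(t)\,\xi_{j,k},$$ where $k$ ranges over a set $K_T$ of integers that contains $0,\dots,T-1$ (possibly all of $\mathbb Z$), the $\xi_{j,k}$ are square integrable with ${\mathbb E}\,\xi_{j,k}=0$ and ${\mathbb E}(\xi_{j,k}\xi_{\ell,m})=\delta_{j,\ell}\delta_{k,m}$, and there are Lipschitz functions $W_j$ (on $(0,1)$ and at the points $k/T$, $k\in K_T$; equivalently, on $\mathbb R$) with Lipschitz constants $L_j$, and constants $C_j$, such that $\sum_j W_j(u)^2$ converges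 uniformly in $u\in(0,1)$, the $L_j$ are bounded, $\sum_j 2^jL_j<\infty$, $\sum_j C_j<\infty$, and $$\sup_{k\in K_T}\bigl|w^0_{j,k;T}-W_j(k/T)\bigr|\le C_j/T\qquad(1\le j\le J,\ T=2^J).$$ Suppose further that $\sum_j C_j^2 2^{2j}<\infty$, $\sum_j L_j^2 2^{2j}<\infty$ and $\sum_j W_j(u)^2 2^{2j}<\infty$ for every $u\in(0,1)$. Let $L(T)\to\infty$ and $L(T)/T\to 0$ as $T\to\infty$. Fix $z\in(0,1)$ such that $W_j(z)\ne 0$ for some $j\ge 1$, and let $Y$ be the stationary process $$Y_s=\sum_{j=1}^\infty W_j(z)\sum_{k=-\infty}^\infty \psi_{j,k}(s)\,\xi'_{j,k}\qquad\text{(in mean square)},$$ where the $\xi'_{j,k}$ are independent and identically distributed with mean zero and unit variance, possibly on another probability space. For observations $x_t$, $t\in A$, where $A$ is a set of $n$ consecutive times, let $\bar x$ be their mean, $\hat\gamma(h)=n^{-1}\sum_{t,\,t+h\in A}(x_{t+h}-\bar x)(x_t-\bar x)$ the sample autocovariances, and for $\tau\ge1$ let the Yule–Walker estimator $\hat q_A(\tau)=\hat\varphi_{\tau,\tau}$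 be the last entry of the solution $\hat\varphi_\tau$ of $\hat\Gamma_\tau\hat\varphi_\tau=\hat\gamma_\tau$, with $\hat\Gamma_\tau=(\hat\gamma(|i-j|))_{i,j=1}^\tau$ and $\hat\gamma_\tau=(\hat\gamma(1),\dots,\hat\gamma(\tau))^T$ (and $\hat q_A(\tau)=0$ if $\hat\Gamma_\tau$ is singular). Let $A_T$ be the set of times $t\in\{0,\dots,T-1\}$ with $t/T\in[z-L(T)/2T,\,z+L(T)/2T]$. Let the windowed estimator $\tilde q_W(z,\tau)$ be $\hat q_{A_T}(\tau)$ computed from the observations $X_{t,T}$, and let $\hat q^Y(\tau)$ be $\hat q_{A_T}(\tau)$ computed from the observations $Y_t$, $t\in A_T$. Then, for every lag $\tau\ge 1$, as $T=2^J\to\infty$, $\tilde q_W(z,\tau)$ converges in distribution to $\hat q^Y(\tau)$, in the sense that both are random variables and $${\mathbb E}\,f\bigl(\tilde q_W(z,\tau)\bigr)-{\mathbb E}\,f\bigl(\hat q^Y(\tau)\bigr)\to 0$$ for every bounded continuous $f:\mathbb R\to\mathbb R$. -/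

import Mathlib

open MeasureTheory ProbabilityTheory Filter Topology
open scoped NNReal ENNReal BoundedContinuousFunction Matrix

noncomputable section

/-- The discrete Haar wavelet `ψ_{j,m}` at scale `j ≥ 1`, of length `N_j = 2 ^ j`. -/
def haarWavelet (j : ℕ) (m : ℤ) : ℝ :=
  if 0 ≤ m ∧ 2 * m < 2 ^ j then (√(2 ^ j))⁻¹
  else if 2 ^ j ≤ 2 * m ∧ m < 2 ^ j then -(√(2 ^ j))⁻¹
  else 0

/-- The nondecimated discrete Haar wavelet `ψ_{j,k}(t) = ψ_{j,k-t}` at scale `j`, location `k`. -/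
def nondecimatedHaar (j : ℕ) (k t : ℤ) : ℝ := haarWavelet j (k - t)

/-- `X T t`, for `T = 2 ^ J` and `0 ≤ t < T`, is a locally stationary wavelet process built on Haar
wavelets, with amplitude functions `W j`, Lipschitz constants `lip j`, process constants `C j`,
amplitudes `w T j k` and random orthonormal increments `ξ j k` (scales `j ≥ 1`).
The range of the locations `k` in the representation is a set `K T` that contains at least
`0, …, T - 1`; it may be all of `ℤ`. `W j` is needed at the points `k / T`, `k ∈ K T`, which can lie
outside `(0, 1)`; as a real Lipschitz function on any set of reals extends to `ℝ` with the
same constant, `W j` is taken to be defined on `ℝ`. All series over `k` have finite support. -/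
structure IsHaarLSW {Ω : Type*} [MeasurableSpace Ω] (P : Measure Ω)
    (W : ℕ → ℝ → ℝ) (lip : ℕ → ℝ≥0) (C : ℕ → ℝ) (K : ℕ → Set ℤ)
    (w : ℕ → ℕ → ℤ → ℝ) (ξ : ℕ → ℤ → Ω → ℝ) (X : ℕ → ℤ → Ω → ℝ) : Prop where
  locations : ∀ J : ℕ, ∀ k : ℤ, 0 ≤ k → k < 2 ^ J → k ∈ K (2 ^ J)
  representation : ∀ J : ℕ, ∀ t : ℤ, 0 ≤ t → t < 2 ^ J →
    X (2 ^ J) t =ᵐ[P] fun ω => ∑ j ∈ Finset.Icc 1 J,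
      ∑' k : K (2 ^ J), w (2 ^ J) j k * nondecimatedHaar j k t * ξ j k ω
  memLp_increment : ∀ j, 1 ≤ j → ∀ k, MemLp (ξ j k) 2 P
  mean_increment : ∀ j, 1 ≤ j → ∀ k, ∫ ω, ξ j k ω ∂P = 0
  orthonormal_increment : ∀ j, 1 ≤ j → ∀ k, ∀ l, 1 ≤ l → ∀ m,
    ∫ ω, ξ j k ω * ξ l m ω ∂P = if j = l ∧ k = m then 1 else 0
  lipschitz : ∀ j, 1 ≤ j → LipschitzWith (lip j) (W j)
  summable_sq : SummableUniformlyOn (fun j z => W j z ^ 2) (Set.Ioo 0 1)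
  bdd_lip : BddAbove (Set.range lip)
  summable_lip : Summable fun j => 2 ^ j * (lip j : ℝ)
  amplitude : ∀ J j : ℕ, 1 ≤ j → j ≤ J → ∀ k ∈ K (2 ^ J),
    |w (2 ^ J) j k - W j ((k : ℝ) / 2 ^ J)| ≤ C j / 2 ^ J
  summable_const : Summable C

/-- For each `T = 2 ^ J`, `(X T t)`, `0 ≤ t < T`, is a Gaussian process. -/
def IsGaussianArray {Ω : Type*} [MeasurableSpace Ω] (P : Measure Ω)
    (X : ℕ → ℤ → Ω → ℝ) : Prop :=
  ∀ J : ℕ, IsGaussianProcess (fun t : Set.Ico (0 : ℤ) (2 ^ J) => X (2 ^ J) t) P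

/-- `Y s = ∑_{j ≥ 1} a j ∑_k ψ_{j,k}(s) ξ j k` in mean square, for independent identically
distributed `ξ j k` (`j ≥ 1`, `k ∈ ℤ`) with mean zero and unit variance. With `a j = W j z` this is
the stationary process that matches a locally stationary wavelet process at rescaled time `z`. -/
structure IsStationaryHaar {Ω : Type*} [MeasurableSpace Ω] (P : Measure Ω)
    (a : ℕ → ℝ) (ξ : ℕ → ℤ → Ω → ℝ) (Y : ℤ → Ω → ℝ) : Prop where
  indep : iIndepFun (fun p : {j : ℕ // 1 ≤ j} × ℤ => ξ p.1 p.2) P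
  identDistrib : ∀ j, 1 ≤ j → ∀ k, ∀ l, 1 ≤ l → ∀ m, IdentDistrib (ξ j k) (ξ l m) P P
  memLp_increment : ∀ j, 1 ≤ j → ∀ k, MemLp (ξ j k) 2 P
  mean_increment : ∀ j, 1 ≤ j → ∀ k, ∫ ω, ξ j k ω ∂P = 0
  variance_increment : ∀ j, 1 ≤ j → ∀ k, variance (ξ j k) P = 1
  memLp : ∀ s, MemLp (Y s) 2 P
  representation : ∀ s, Tendsto (fun n : ℕ => eLpNorm (fun ω => Y s ω -
      ∑ j ∈ Finset.Icc 1 n, a j * ∑' k : ℤ, nondecimatedHaar j k s * ξ j k ω) 2 P)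
    atTop (𝓝 0)

/-- Sample mean of the observations `x t`, `t ∈ A`. -/
def sampleMean (A : Finset ℤ) (x : ℤ → ℝ) : ℝ := (∑ t ∈ A, x t) / A.card

/-- Usual sample autocovariance at lag `h` of the observations `x t`, `t ∈ A`, where `A` is a set of
consecutive times. -/
def sampleAutocov (A : Finset ℤ) (x : ℤ → ℝ) (h : ℕ) : ℝ :=
  (∑ t ∈ A with t + (h : ℤ) ∈ A, (x (t + h) - sampleMean A x) * (x t - sampleMean A x)) / A.card

/-- Classical Yule–Walker estimator of the partial autocorrelation at lag `τ` based on the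
observations `x t`, `t ∈ A`: the last entry of the solution `φ` of `Γ φ = γ`, with
`Γ = (γ(|i - j|))` and `γ = (γ(1), …, γ(τ))` made of sample autocovariances. For `τ ≥ 1`, the value
is `0` if `Γ` is singular (which is when all the observations are equal). -/
def samplePacf (A : Finset ℤ) (x : ℤ → ℝ) (τ : ℕ) : ℝ :=
  if hτ : 0 < τ then
    ((Matrix.of fun i j : Fin τ => sampleAutocov A x ((i : ℤ) - (j : ℤ)).natAbs)⁻¹ *ᵥ
      fun i : Fin τ => sampleAutocov A x ((i : ℕ) + 1)) ⟨τ - 1, by omega⟩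
  else 1

/-- The times `t ∈ {0, …, T - 1}` whose rescaled time `t / T` lies in
`[z - ℓ / (2T), z + ℓ / (2T)]`. -/
def windowTimes (z : ℝ) (ℓ : ℝ) (T : ℕ) : Finset ℤ :=
  {t ∈ Finset.Ico (0 : ℤ) T |
    (t : ℝ) / T ∈ Set.Icc (z - ℓ / (2 * T)) (z + ℓ / (2 * T))}

/-- The laws of the real random variables `U n` and `V n` approach each other weakly: the integrals
of every bounded continuous function under the two laws have the same asymptotics. If `V n` does
not depend on `n`, this is convergence in distribution of `U n` to `V`. -/
structure ConvergesInLawTo {Ω Ω' : Type*} [MeasurableSpace Ω] [MeasurableSpace Ω']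
    (U : ℕ → Ω → ℝ) (P : Measure Ω) (V : ℕ → Ω' → ℝ) (P' : Measure Ω') : Prop where
  aemeasurable_left : ∀ n, AEMeasurable (U n) P
  aemeasurable_right : ∀ n, AEMeasurable (V n) P'
  tendsto : ∀ f : ℝ →ᵇ ℝ,
    Tendsto (fun n => ∫ ω, f (U n ω) ∂P - ∫ ω, f (V n ω) ∂P') atTop (𝓝 0)

end

/-! ### Haar autocorrelations and the limiting autocovariance. -/

noncomputable section

/-! Both estimators are consistent for the same constant, the lag-`τ` partial autocorrelation
computed from γ(h) = ∑_j W_j(z)² Ψ_j(h), where Ψ_j is the Haar autocorrelation (`haarAutocov`). So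
the expectations of `f` have a common limit and their difference tends to zero.

On the windows, X and Y are approximated in mean square by Haar sums over finitely many scales with
the frozen amplitudes W_j(z), each with its own increments (`IsHaarApprox`). For X the amplitudes
vary little because the window shrinks in rescaled time, and the coarse scales carry little
variance. Hence covariances converge to γ uniformly over the window (`IsHaarApprox.abs_cov_sub_le`).
Since γ vanishes at infinity, the arrays are weakly correlated, and their averages vanish in mean
square (`tendsto_integral_average_sq`).

Sample autocovariances also need a law of large numbers for products at a fixed lag. The increments
of X are only orthonormal, but X is Gaussian, so the covariances of squares are squared covariances
(`integral_sq_mul_sq_of_hasGaussianLaw`). Y need not be Gaussian nor have fourth moments, but its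
increments are independent and identically distributed. Truncating them leaves bounded products that
are independent at long distances (`indepFun_haarSum_mul`).

Finally, the Yule–Walker map is continuous at γ: a nonzero W_j(z) makes the Toeplitz matrices of γ
positive definite (`haarAutocov_quadratic_pos`), so convergence in mean of the sample
autocovariances passes to the estimator. -/

theorem haarWavelet_eq_zero {j : ℕ} {m : ℤ} (h : m ∉ Finset.Ico (0 : ℤ) (2 ^ j)) :
    haarWavelet j m = 0 := by
  rw [Finset.mem_Ico] at h
  have hp : (0 : ℤ) < 2 ^ j := by positivity
  unfold haarWavelet
  rw [if_neg, if_neg] <;> omega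

theorem haarWavelet_sq {j : ℕ} {m : ℤ} (h : m ∈ Finset.Ico (0 : ℤ) (2 ^ j)) :
    haarWavelet j m ^ 2 = (2 ^ j)⁻¹ := by
  rw [Finset.mem_Ico] at h
  have hs : ((√(2 ^ j : ℝ))⁻¹) ^ 2 = (2 ^ j)⁻¹ := by
    rw [inv_pow, Real.sq_sqrt (by positivity)]
  unfold haarWavelet
  split_ifs with h1 h2
  · exact hs
  · rw [neg_sq, hs]
  · omega

theorem haarWavelet_zero_ne_zero (j : ℕ) : haarWavelet j 0 ≠ 0 := by
  have : (0 : ℤ) < 2 ^ j := by positivity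
  unfold haarWavelet
  rw [if_pos (by constructor <;> simp)]
  positivity

theorem sum_haarWavelet_sq (j : ℕ) : ∑ m ∈ Finset.Ico (0 : ℤ) (2 ^ j), haarWavelet j m ^ 2 = 1 := by
  rw [Finset.sum_congr rfl fun m hm => haarWavelet_sq hm]
  rw [Finset.sum_const, Int.card_Ico, nsmul_eq_mul, sub_zero]
  have : (((2 : ℤ) ^ j).toNat : ℝ) = 2 ^ j := by
    have : ((2 : ℤ) ^ j).toNat = 2 ^ j := by
      rw [show ((2 : ℤ) ^ j) = ((2 ^ j : ℕ) : ℤ) by push_cast; rfl, Int.toNat_natCast]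
    rw [this]; push_cast; rfl
  rw [this]
  field_simp

theorem nondecimatedHaar_eq_zero {j : ℕ} {k t : ℤ} (h : k ∉ Finset.Ico t (t + 2 ^ j)) :
    nondecimatedHaar j k t = 0 := by
  apply haarWavelet_eq_zero
  rw [Finset.mem_Ico] at h ⊢
  omega

/-- Substitute k = m + t. Since `B` only has to contain the support at time `t`, two or more times
can share one index set. -/
theorem sum_nondecimatedHaar_mul (j : ℕ) (t s : ℤ) {B : Finset ℤ}
    (hB : Finset.Ico t (t + 2 ^ j) ⊆ B) :
    ∑ k ∈ B, nondecimatedHaar j k t * nondecimatedHaar j k s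
      = ∑ m ∈ Finset.Ico (0 : ℤ) (2 ^ j), haarWavelet j m * haarWavelet j (m - (s - t)) := by
  rw [← Finset.sum_subset hB fun k _ hk => by rw [nondecimatedHaar_eq_zero hk, zero_mul]]
  symm
  refine Finset.sum_bij (fun m _ => m + t) ?_ ?_ ?_ ?_
  · intro m hm
    simp only [Finset.mem_Ico] at hm ⊢
    omega
  · intro a _ b _ h
    simpa using h
  · intro b hb
    refine ⟨b - t, ?_, by ring⟩
    simp only [Finset.mem_Ico] at hb ⊢
    omega
  · intro m _
    simp only [nondecimatedHaar]
    congr 2 <;> ring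

/-- The autocorrelation of the discrete Haar wavelet at scale `j`. -/
def haarAutocorr (j : ℕ) (h : ℤ) : ℝ :=
  ∑ m ∈ Finset.Ico (0 : ℤ) (2 ^ j), haarWavelet j m * haarWavelet j (m - h)

theorem haarAutocorr_zero (j : ℕ) : haarAutocorr j 0 = 1 := by
  rw [← sum_haarWavelet_sq j]
  simp only [haarAutocorr, sub_zero, sq]

theorem sum_nondecimatedHaar_sq (j : ℕ) (t : ℤ) {B : Finset ℤ}
    (hB : Finset.Ico t (t + 2 ^ j) ⊆ B) : ∑ k ∈ B, nondecimatedHaar j k t ^ 2 = 1 := by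
  simp only [sq]
  rw [sum_nondecimatedHaar_mul j t t hB, ← haarAutocorr_zero j, haarAutocorr, sub_self]

theorem haarAutocorr_neg (j : ℕ) (h : ℤ) : haarAutocorr j (-h) = haarAutocorr j h := by
  have hl : Finset.Ico (0 : ℤ) (0 + 2 ^ j) ⊆
      Finset.Ico (0 : ℤ) (0 + 2 ^ j) ∪ Finset.Ico h (h + 2 ^ j) := Finset.subset_union_left
  have hr : Finset.Ico h (h + 2 ^ j) ⊆
      Finset.Ico (0 : ℤ) (0 + 2 ^ j) ∪ Finset.Ico h (h + 2 ^ j) := Finset.subset_union_right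
  have h1 := sum_nondecimatedHaar_mul j 0 h hl
  have h2 := sum_nondecimatedHaar_mul j h 0 hr
  simp only [sub_zero, zero_sub] at h1 h2
  rw [haarAutocorr, haarAutocorr, ← h1, ← h2]
  exact Finset.sum_congr rfl fun k _ => mul_comm _ _

theorem haarAutocorr_eq_zero {j : ℕ} {h : ℤ} (hh : 2 ^ j ≤ |h|) : haarAutocorr j h = 0 := by
  refine Finset.sum_eq_zero fun m hm => ?_
  rw [haarWavelet_eq_zero (m := m - h), mul_zero]
  rw [Finset.mem_Ico] at hm ⊢
  rcases abs_cases h with h' | h' <;> omega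

/-- Cauchy–Schwarz for two translates of a unit vector. -/
theorem abs_haarAutocorr_le_one (j : ℕ) (h : ℤ) : |haarAutocorr j h| ≤ 1 := by
  have hl : Finset.Ico (0 : ℤ) (0 + 2 ^ j) ⊆
      Finset.Ico (0 : ℤ) (0 + 2 ^ j) ∪ Finset.Ico h (h + 2 ^ j) := Finset.subset_union_left
  have hr : Finset.Ico h (h + 2 ^ j) ⊆
      Finset.Ico (0 : ℤ) (0 + 2 ^ j) ∪ Finset.Ico h (h + 2 ^ j) := Finset.subset_union_right
  have h1 := sum_nondecimatedHaar_mul j 0 h hl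
  simp only [sub_zero] at h1
  have hcs := Finset.sum_mul_sq_le_sq_mul_sq
    (Finset.Ico (0 : ℤ) (0 + 2 ^ j) ∪ Finset.Ico h (h + 2 ^ j))
    (fun k => nondecimatedHaar j k 0) (fun k => nondecimatedHaar j k h)
  rw [sum_nondecimatedHaar_sq j 0 hl, sum_nondecimatedHaar_sq j h hr, h1, mul_one] at hcs
  exact (sq_le_one_iff_abs_le_one _).mp hcs

/-- The autocovariance of `∑_{1 ≤ j ≤ M} a j ∑_k ψ_{j,k}(t) ξ j k`, for orthonormal `ξ j k`. -/
def partialHaarAutocov (a : ℕ → ℝ) (M : ℕ) (h : ℤ) : ℝ :=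
  ∑ j ∈ Finset.Icc 1 M, a j ^ 2 * haarAutocorr j h

/-- The autocovariance of `∑_{j ≥ 1} a j ∑_k ψ_{j,k}(t) ξ j k`, for orthonormal `ξ j k`. -/
def haarAutocov (a : ℕ → ℝ) (h : ℤ) : ℝ :=
  ∑' j : ℕ, a (j + 1) ^ 2 * haarAutocorr (j + 1) h

/-- The variance contributed by the scales above `M`. -/
def scaleTail (a : ℕ → ℝ) (M : ℕ) : ℝ := ∑' j : ℕ, a (j + M + 1) ^ 2

variable {a : ℕ → ℝ}

theorem sum_Icc_one_eq_sum_range {β : Type*} [AddCommMonoid β] (f : ℕ → β) (M : ℕ) :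
    ∑ j ∈ Finset.Icc 1 M, f j = ∑ j ∈ Finset.range M, f (j + 1) := by
  rw [Finset.range_eq_Ico, Finset.sum_Ico_add' f 0 M 1]
  rfl

theorem scaleTail_nonneg (a : ℕ → ℝ) (M : ℕ) : 0 ≤ scaleTail a M :=
  tsum_nonneg fun _ => sq_nonneg _

theorem tendsto_scaleTail (a : ℕ → ℝ) : Tendsto (scaleTail a) atTop (𝓝 0) := by
  have := tendsto_sum_nat_add fun j => a (j + 1) ^ 2
  exact this

theorem scaleTail_zero_eq (ha : Summable fun j => a j ^ 2) (M : ℕ) :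
    scaleTail a 0 = ∑ j ∈ Finset.Icc 1 M, a j ^ 2 + scaleTail a M := by
  rw [sum_Icc_one_eq_sum_range]
  exact (((summable_nat_add_iff 1).2 ha).sum_add_tsum_nat_add M).symm

theorem sum_filter_lt_le_scaleTail (ha : Summable fun j => a j ^ 2) {M J : ℕ} (h : M ≤ J) :
    ∑ j ∈ Finset.Icc 1 J with M < j, a j ^ 2 ≤ scaleTail a M := by
  have h1 := scaleTail_zero_eq ha M
  have h2 := scaleTail_zero_eq ha J
  have h3 := Finset.sum_filter_add_sum_filter_not (Finset.Icc 1 J) (fun j => M < j)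
    (fun j => a j ^ 2)
  have h4 : Finset.filter (fun j => ¬ M < j) (Finset.Icc 1 J) = Finset.Icc 1 M := by
    ext j
    simp only [Finset.mem_filter, Finset.mem_Icc]
    omega
  rw [h4] at h3
  have := scaleTail_nonneg a J
  linarith

theorem summable_haarAutocov (ha : Summable fun j => a j ^ 2) (h : ℤ) :
    Summable fun j => a j ^ 2 * haarAutocorr j h := by
  refine Summable.of_norm_bounded ha fun j => ?_
  rw [norm_mul, Real.norm_eq_abs, Real.norm_eq_abs, abs_sq]
  exact mul_le_of_le_one_right (sq_nonneg _) (abs_haarAutocorr_le_one _ _)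

theorem abs_haarAutocov_sub_le (ha : Summable fun j => a j ^ 2) (M : ℕ) (h : ℤ) :
    |haarAutocov a h - partialHaarAutocov a M h| ≤ scaleTail a M := by
  have hs := summable_haarAutocov ha h
  have h1 := ((summable_nat_add_iff 1).2 hs).sum_add_tsum_nat_add M
  rw [haarAutocov, ← h1, partialHaarAutocov, sum_Icc_one_eq_sum_range, add_sub_cancel_left,
    ← Real.norm_eq_abs]
  refine tsum_of_norm_bounded (g := fun j => a (j + M + 1) ^ 2) ?_ fun j => ?_
  · exact ((summable_nat_add_iff (M + 1)).2 ha).hasSum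
  · rw [norm_mul, Real.norm_eq_abs, Real.norm_eq_abs, abs_sq]
    exact mul_le_of_le_one_right (sq_nonneg _) (abs_haarAutocorr_le_one _ _)

theorem tendsto_partialHaarAutocov (ha : Summable fun j => a j ^ 2) (h : ℤ) :
    Tendsto (fun M => partialHaarAutocov a M h) atTop (𝓝 (haarAutocov a h)) := by
  rw [tendsto_iff_dist_tendsto_zero]
  refine squeeze_zero (fun _ => dist_nonneg) (fun M => ?_) (tendsto_scaleTail a)
  rw [dist_comm]
  exact abs_haarAutocov_sub_le ha M h

theorem partialHaarAutocov_eq_zero {M : ℕ} {h : ℤ} (hh : 2 ^ M ≤ |h|) :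
    partialHaarAutocov a M h = 0 := by
  refine Finset.sum_eq_zero fun j hj => ?_
  rw [haarAutocorr_eq_zero, mul_zero]
  exact (pow_le_pow_right₀ (by norm_num) (Finset.mem_Icc.1 hj).2).trans hh

/-- The scales up to `M` give no covariance at lags of size 2^M or more, and the remaining scales
contribute at most `scaleTail a M`, whatever the lag. -/
theorem exists_abs_haarAutocov_le (ha : Summable fun j => a j ^ 2) {ε : ℝ} (hε : 0 < ε) :
    ∃ m : ℕ, ∀ h : ℤ, (m : ℤ) < |h| → |haarAutocov a h| ≤ ε := by
  obtain ⟨M, hM⟩ := ((tendsto_scaleTail a).eventually_le_const hε).exists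
  refine ⟨2 ^ M, fun h hh => ?_⟩
  have := abs_haarAutocov_sub_le ha M h
  rw [partialHaarAutocov_eq_zero (by push_cast at hh; exact hh.le), sub_zero] at this
  exact this.trans hM

theorem haarAutocov_neg (a : ℕ → ℝ) (h : ℤ) : haarAutocov a (-h) = haarAutocov a h := by
  simp only [haarAutocov, haarAutocorr_neg]

theorem haarAutocov_natAbs (a : ℕ → ℝ) (h : ℤ) : haarAutocov a (h.natAbs : ℤ) = haarAutocov a h := by
  rcases Int.natAbs_eq h with h' | h'
  · rw [← h']
  · rw [h', haarAutocov_neg]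
    simp

theorem abs_haarAutocov_le (ha : Summable fun j => a j ^ 2) (h : ℤ) :
    |haarAutocov a h| ≤ scaleTail a 0 := by
  have := abs_haarAutocov_sub_le ha 0 h
  simpa [partialHaarAutocov] using this

/-- The autocovariance matrix of a Haar process with a nonzero amplitude is definite. -/
theorem haarAutocov_quadratic_pos (ha : Summable fun j => a j ^ 2) (hne : ∃ j, 1 ≤ j ∧ a j ≠ 0)
    {n : ℕ} (v : Fin n → ℝ) (hv : v ≠ 0) :
    0 < ∑ i, ∑ l, v i * v l * haarAutocov a ((i : ℤ) - (l : ℤ)) := by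
  obtain ⟨j₀, hj₀, haj⟩ := hne
  -- The quadratic form of scale `j`, written as a sum of squares over all locations whose wavelets
  -- meet the times 0, …, n - 1.
  set q : ℕ → ℝ := fun j => ∑ k ∈ Finset.Ico (0 : ℤ) (n + 2 ^ j),
    (∑ i : Fin n, v i * nondecimatedHaar j k (i : ℤ)) ^ 2 with hq
  have hq' : ∀ j, ∑ i, ∑ l, v i * v l * haarAutocorr j ((i : ℤ) - (l : ℤ)) = q j := by
    intro j
    simp only [hq, sq, Finset.sum_mul_sum]
    symm
    rw [Finset.sum_comm]
    refine Finset.sum_congr rfl fun i _ => ?_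
    rw [Finset.sum_comm]
    refine Finset.sum_congr rfl fun l _ => ?_
    rw [show ∀ x y : ℤ, haarAutocorr j (x - y) = haarAutocorr j (y - x) from
      fun x y => by rw [← haarAutocorr_neg, neg_sub], haarAutocorr,
      ← sum_nondecimatedHaar_mul j (i : ℤ) (l : ℤ) (B := Finset.Ico (0 : ℤ) (n + 2 ^ j)),
      Finset.mul_sum]
    · exact Finset.sum_congr rfl fun k _ => by ring
    · intro k hk
      have := i.2
      simp only [Finset.mem_Ico] at hk ⊢
      omega
  have hqn : ∀ j, 0 ≤ q j := fun j => Finset.sum_nonneg fun _ _ => sq_nonneg _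
  have hpos : 0 < q j₀ := by
    obtain ⟨i₀, hi₀⟩ := Function.ne_iff.1 hv
    have hne : (Finset.univ.filter fun i => v i ≠ 0).Nonempty := ⟨i₀, by simpa using hi₀⟩
    -- At the location equal to the first index with `v i ≠ 0` only one term survives: earlier
    -- coefficients vanish, and wavelets of later times start to the right of it.
    set i := (Finset.univ.filter fun i => v i ≠ 0).min' hne with hi
    have hvi : v i ≠ 0 := by simpa using Finset.min'_mem _ hne
    have hlt : ∀ l < i, v l = 0 := by
      intro l hl
      by_contra hne'
      exact absurd (Finset.min'_le _ l (by simpa using hne')) (not_le.2 hl)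
    have hsum : ∑ l : Fin n, v l * nondecimatedHaar j₀ (i : ℤ) (l : ℤ) = v i * haarWavelet j₀ 0 := by
      rw [Finset.sum_eq_single i]
      · simp [nondecimatedHaar]
      · intro l _ hl
        rcases lt_or_gt_of_ne hl with h | h
        · rw [hlt l h, zero_mul]
        · rw [nondecimatedHaar_eq_zero, mul_zero]
          have : (i : ℕ) < l := h
          simp only [Finset.mem_Ico]
          omega
      · simp
    refine lt_of_lt_of_le ?_ (Finset.single_le_sum
      (f := fun k : ℤ => (∑ i : Fin n, v i * nondecimatedHaar j₀ k (i : ℤ)) ^ 2)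
      (fun _ _ => sq_nonneg _) (a := (i : ℤ)) ?_)
    · simp only [hsum]
      exact sq_pos_of_ne_zero (mul_ne_zero hvi (haarWavelet_zero_ne_zero j₀))
    · have := i.2
      have : (0 : ℤ) < 2 ^ j₀ := by positivity
      simp only [Finset.mem_Ico]
      omega
  have hlim : Tendsto (fun M => ∑ j ∈ Finset.Icc 1 M, a j ^ 2 * q j) atTop
      (𝓝 (∑ i, ∑ l, v i * v l * haarAutocov a ((i : ℤ) - (l : ℤ)))) := by
    have : (fun M => ∑ j ∈ Finset.Icc 1 M, a j ^ 2 * q j) =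
        fun M => ∑ i, ∑ l, v i * v l * partialHaarAutocov a M ((i : ℤ) - (l : ℤ)) := by
      funext M
      simp only [partialHaarAutocov, ← hq', Finset.mul_sum]
      rw [Finset.sum_comm]
      refine Finset.sum_congr rfl fun i _ => ?_
      rw [Finset.sum_comm]
      refine Finset.sum_congr rfl fun l _ => Finset.sum_congr rfl fun j _ => by ring
    rw [this]
    refine tendsto_finsetSum _ fun i _ => tendsto_finsetSum _ fun l _ => ?_
    exact (tendsto_partialHaarAutocov ha _).const_mul _
  refine (mul_pos (sq_pos_of_ne_zero haj) hpos).trans_le (ge_of_tendsto hlim ?_)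
  filter_upwards [eventually_ge_atTop j₀] with M hM
  exact Finset.single_le_sum (f := fun j => a j ^ 2 * q j)
    (fun j _ => mul_nonneg (sq_nonneg _) (hqn j)) (Finset.mem_Icc.2 ⟨hj₀, hM⟩)
end

/-! ### Finite Haar sums, orthonormal increments and mean square approximation. -/

noncomputable section

variable {Ω : Type*} {ξ : ℕ → ℤ → Ω → ℝ}

/-- The finite Haar sum `∑_{1 ≤ j ≤ M} a j ∑_k ψ_{j,k}(t) ξ j k`. -/
def haarSum (a : ℕ → ℝ) (ξ : ℕ → ℤ → Ω → ℝ) (M : ℕ) (t : ℤ) (ω : Ω) : ℝ :=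
  ∑ p ∈ Finset.Icc 1 M ×ˢ Finset.Ico t (t + 2 ^ M),
    a p.1 * nondecimatedHaar p.1 p.2 t * ξ p.1 p.2 ω

variable {a : ℕ → ℝ} {M : ℕ}

theorem Ico_scale_subset {j : ℕ} (h : j ≤ M) (t : ℤ) :
    Finset.Ico t (t + 2 ^ j) ⊆ Finset.Ico t (t + 2 ^ M) := by
  have : (2 : ℤ) ^ j ≤ 2 ^ M := pow_le_pow_right₀ (by norm_num) h
  exact Finset.Ico_subset_Ico le_rfl (by omega)

theorem haarSum_eq {t : ℤ} {B : Finset ℤ} (hB : Finset.Ico t (t + 2 ^ M) ⊆ B) (ω : Ω) :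
    haarSum a ξ M t ω = ∑ p ∈ Finset.Icc 1 M ×ˢ B,
      a p.1 * nondecimatedHaar p.1 p.2 t * ξ p.1 p.2 ω := by
  refine Finset.sum_subset (Finset.product_subset_product_right hB) fun p hp hp' => ?_
  rw [Finset.mem_product] at hp hp'
  have h1 := (Finset.mem_Icc.1 hp.1).2
  rw [nondecimatedHaar_eq_zero, mul_zero, zero_mul]
  exact fun h => hp' ⟨hp.1, Ico_scale_subset h1 t h⟩

theorem haarSum_eq_tsum (t : ℤ) (ω : Ω) : haarSum a ξ M t ω =
    ∑ j ∈ Finset.Icc 1 M, a j * ∑' k : ℤ, nondecimatedHaar j k t * ξ j k ω := by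
  rw [haarSum, Finset.sum_product]
  refine Finset.sum_congr rfl fun j hj => ?_
  rw [tsum_eq_sum (s := Finset.Ico t (t + 2 ^ M)), Finset.mul_sum]
  · exact Finset.sum_congr rfl fun k _ => by ring
  · intro k hk
    rw [nondecimatedHaar_eq_zero, zero_mul]
    exact fun h => hk (Ico_scale_subset (Finset.mem_Icc.1 hj).2 t h)

variable [MeasurableSpace Ω] {P : Measure Ω}

theorem integral_abs_mul_le_of_sq_le {f g : Ω → ℝ} (hf : MemLp f 2 P) (hg : MemLp g 2 P)
    {b c : ℝ} (hb : 0 ≤ b) (hc : 0 ≤ c) (hfb : ∫ ω, f ω ^ 2 ∂P ≤ b ^ 2)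
    (hgc : ∫ ω, g ω ^ 2 ∂P ≤ c ^ 2) : ∫ ω, |f ω * g ω| ∂P ≤ b * c := by
  have h := integral_mul_norm_le_Lp_mul_Lq (μ := P) Real.HolderConjugate.two_two
    (f := f) (g := g) (by simpa using hf) (by simpa using hg)
  simp only [Real.norm_eq_abs, Real.rpow_ofNat, sq_abs, ← Real.sqrt_eq_rpow] at h
  simp only [abs_mul]
  refine h.trans (mul_le_mul ?_ ?_ (Real.sqrt_nonneg _) hb)
  · exact (Real.sqrt_le_sqrt hfb).trans (Real.sqrt_sq hb).le
  · exact (Real.sqrt_le_sqrt hgc).trans (Real.sqrt_sq hc).le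

theorem abs_integral_mul_le_of_sq_le {f g : Ω → ℝ} (hf : MemLp f 2 P) (hg : MemLp g 2 P)
    {b c : ℝ} (hb : 0 ≤ b) (hc : 0 ≤ c) (hfb : ∫ ω, f ω ^ 2 ∂P ≤ b ^ 2)
    (hgc : ∫ ω, g ω ^ 2 ∂P ≤ c ^ 2) : |∫ ω, f ω * g ω ∂P| ≤ b * c :=
  abs_integral_le_integral_abs.trans (integral_abs_mul_le_of_sq_le hf hg hb hc hfb hgc)

theorem integral_abs_le_of_sq_le [IsProbabilityMeasure P] {f : Ω → ℝ} (hf : MemLp f 2 P)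
    {b : ℝ} (hb : 0 ≤ b) (hfb : ∫ ω, f ω ^ 2 ∂P ≤ b ^ 2) : ∫ ω, |f ω| ∂P ≤ b := by
  simpa using integral_abs_mul_le_of_sq_le hf (memLp_const (1 : ℝ)) hb zero_le_one hfb (by simp)

/-- Comparing products of square integrable functions. -/
theorem integral_abs_mul_sub_mul_le {f g f' g' : Ω → ℝ} (hf : MemLp f 2 P) (hg : MemLp g 2 P)
    (hf' : MemLp f' 2 P) (hg' : MemLp g' 2 P) {b c : ℝ} (hb : 0 ≤ b) (hc : 0 ≤ c)
    (hff : ∫ ω, (f ω - f' ω) ^ 2 ∂P ≤ b ^ 2) (hgg : ∫ ω, (g ω - g' ω) ^ 2 ∂P ≤ b ^ 2)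
    (hfc : ∫ ω, f ω ^ 2 ∂P ≤ c ^ 2) (hgc : ∫ ω, g ω ^ 2 ∂P ≤ c ^ 2) :
    ∫ ω, |f ω * g ω - f' ω * g' ω| ∂P ≤ b * (b + 2 * c) := by
  have h1 := integral_abs_mul_le_of_sq_le (hf.sub hf') (hg.sub hg') hb hb hff hgg
  have h2 := integral_abs_mul_le_of_sq_le (hf.sub hf') hg hb hc hff hgc
  have h3 := integral_abs_mul_le_of_sq_le hf (hg.sub hg') hc hb hfc hgg
  have i1 := ((hf.sub hf').integrable_mul (hg.sub hg')).abs
  have i2 := ((hf.sub hf').integrable_mul hg).abs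
  have i3 := (hf.integrable_mul (hg.sub hg')).abs
  calc ∫ ω, |f ω * g ω - f' ω * g' ω| ∂P
      ≤ ∫ ω, (|((f - f') * (g - g')) ω| + |((f - f') * g) ω| + |(f * (g - g')) ω|) ∂P := by
        refine integral_mono ((hf.integrable_mul hg).sub (hf'.integrable_mul hg')).abs
          ((i1.add i2).add i3) fun ω => ?_
        simp only [Pi.mul_apply, Pi.sub_apply]
        -- This splitting uses the norms of `f`, `g` and of the differences only, so no bound on
        -- `f'`, `g'` is needed.
        calc |f ω * g ω - f' ω * g' ω| = |-((f ω - f' ω) * (g ω - g' ω)) + (f ω - f' ω) * g ω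
              + f ω * (g ω - g' ω)| := by congr 1; ring
          _ ≤ _ := by
            refine (abs_add_le _ _).trans (add_le_add_left ((abs_add_le _ _).trans ?_) _)
            rw [abs_neg]
    _ = ∫ ω, |((f - f') * (g - g')) ω| ∂P + ∫ ω, |((f - f') * g) ω| ∂P
          + ∫ ω, |(f * (g - g')) ω| ∂P := by
        exact (integral_add (i1.add i2) i3).trans (congrArg (· + _) (integral_add i1 i2))
    _ ≤ b * b + b * c + c * b := add_le_add (add_le_add h1 h2) h3
    _ = b * (b + 2 * c) := by ring

/-- A centred orthonormal array of random variables, indexed by scales `j ≥ 1` and locations. -/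
structure IsOrthonormalArray (P : Measure Ω) (ξ : ℕ → ℤ → Ω → ℝ) : Prop where
  memLp : ∀ j, 1 ≤ j → ∀ k, MemLp (ξ j k) 2 P
  mean : ∀ j, 1 ≤ j → ∀ k, ∫ ω, ξ j k ω ∂P = 0
  inner : ∀ j, 1 ≤ j → ∀ k, ∀ l, 1 ≤ l → ∀ m,
    ∫ ω, ξ j k ω * ξ l m ω ∂P = if j = l ∧ k = m then 1 else 0

namespace IsOrthonormalArray

theorem memLp_sum (hξ : IsOrthonormalArray P ξ) {S : Finset (ℕ × ℤ)} (hS : ∀ p ∈ S, 1 ≤ p.1)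
    (c : ℕ × ℤ → ℝ) : MemLp (fun ω => ∑ p ∈ S, c p * ξ p.1 p.2 ω) 2 P :=
  memLp_finsetSum _ fun p hp => (hξ.memLp p.1 (hS p hp) p.2).const_mul _

theorem integral_sum (hξ : IsOrthonormalArray P ξ) [IsFiniteMeasure P] {S : Finset (ℕ × ℤ)}
    (hS : ∀ p ∈ S, 1 ≤ p.1) (c : ℕ × ℤ → ℝ) : ∫ ω, ∑ p ∈ S, c p * ξ p.1 p.2 ω ∂P = 0 := by
  rw [integral_finsetSum _ fun p hp =>
    ((hξ.memLp p.1 (hS p hp) p.2).integrable (by norm_num)).const_mul _]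
  refine Finset.sum_eq_zero fun p hp => ?_
  rw [integral_const_mul, hξ.mean p.1 (hS p hp), mul_zero]

theorem integral_sum_mul_sum (hξ : IsOrthonormalArray P ξ) {S : Finset (ℕ × ℤ)}
    (hS : ∀ p ∈ S, 1 ≤ p.1) (c d : ℕ × ℤ → ℝ) :
    ∫ ω, (∑ p ∈ S, c p * ξ p.1 p.2 ω) * ∑ p ∈ S, d p * ξ p.1 p.2 ω ∂P = ∑ p ∈ S, c p * d p := by
  have hint : ∀ p ∈ S, ∀ q ∈ S,
      Integrable (fun ω => c p * ξ p.1 p.2 ω * (d q * ξ q.1 q.2 ω)) P := fun p hp q hq =>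
    ((hξ.memLp p.1 (hS p hp) p.2).const_mul (c p)).integrable_mul
      ((hξ.memLp q.1 (hS q hq) q.2).const_mul (d q))
  simp only [Finset.sum_mul_sum]
  rw [integral_finsetSum _ fun p hp => integrable_finsetSum _ fun q hq => hint p hp q hq]
  refine Finset.sum_congr rfl fun p hp => ?_
  rw [integral_finsetSum _ fun q hq => hint p hp q hq, Finset.sum_eq_single p]
  · have : ∀ ω, c p * ξ p.1 p.2 ω * (d p * ξ p.1 p.2 ω)
        = c p * d p * (ξ p.1 p.2 ω * ξ p.1 p.2 ω) := fun ω => by ring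
    simp only [this]
    rw [integral_const_mul, hξ.inner _ (hS p hp) _ _ (hS p hp)]
    simp
  · intro q hq hqp
    have : ∀ ω, c p * ξ p.1 p.2 ω * (d q * ξ q.1 q.2 ω)
        = c p * d q * (ξ p.1 p.2 ω * ξ q.1 q.2 ω) := fun ω => by ring
    simp only [this]
    rw [integral_const_mul, hξ.inner _ (hS p hp) _ _ (hS q hq), if_neg, mul_zero]
    rintro ⟨h1, h2⟩
    exact hqp (Prod.ext h1.symm h2.symm)
  · exact fun h => absurd hp h

theorem integral_sum_sq (hξ : IsOrthonormalArray P ξ) {S : Finset (ℕ × ℤ)}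
    (hS : ∀ p ∈ S, 1 ≤ p.1) (c : ℕ × ℤ → ℝ) :
    ∫ ω, (∑ p ∈ S, c p * ξ p.1 p.2 ω) ^ 2 ∂P = ∑ p ∈ S, c p ^ 2 := by
  simp only [sq]
  exact hξ.integral_sum_mul_sum hS c c

end IsOrthonormalArray

theorem one_le_of_mem_product {B : Finset ℤ} : ∀ p ∈ Finset.Icc 1 M ×ˢ B, 1 ≤ p.1 :=
  fun _ hp => (Finset.mem_Icc.1 (Finset.mem_product.1 hp).1).1

theorem memLp_haarSum (hξ : IsOrthonormalArray P ξ) (a : ℕ → ℝ) (M : ℕ) (t : ℤ) :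
    MemLp (haarSum a ξ M t) 2 P :=
  hξ.memLp_sum one_le_of_mem_product fun p => a p.1 * nondecimatedHaar p.1 p.2 t

theorem integral_haarSum_mul (hξ : IsOrthonormalArray P ξ) (a : ℕ → ℝ) (M : ℕ) (t s : ℤ) :
    ∫ ω, haarSum a ξ M t ω * haarSum a ξ M s ω ∂P = partialHaarAutocov a M (s - t) := by
  have hl : Finset.Ico t (t + 2 ^ M) ⊆
      Finset.Ico t (t + 2 ^ M) ∪ Finset.Ico s (s + 2 ^ M) := Finset.subset_union_left
  have hr : Finset.Ico s (s + 2 ^ M) ⊆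
      Finset.Ico t (t + 2 ^ M) ∪ Finset.Ico s (s + 2 ^ M) := Finset.subset_union_right
  simp only [haarSum_eq hl, haarSum_eq hr]
  rw [hξ.integral_sum_mul_sum one_le_of_mem_product (fun p => a p.1 * nondecimatedHaar p.1 p.2 t)
    (fun p => a p.1 * nondecimatedHaar p.1 p.2 s), Finset.sum_product, partialHaarAutocov]
  refine Finset.sum_congr rfl fun j hj => ?_
  rw [haarAutocorr, ← sum_nondecimatedHaar_mul j t s
    ((Ico_scale_subset (Finset.mem_Icc.1 hj).2 t).trans hl), Finset.mul_sum]
  exact Finset.sum_congr rfl fun k _ => by ring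

theorem integral_haarSum_sq_le (hξ : IsOrthonormalArray P ξ) (ha : Summable fun j => a j ^ 2)
    (M : ℕ) (t : ℤ) : ∫ ω, haarSum a ξ M t ω ^ 2 ∂P ≤ scaleTail a 0 := by
  simp only [sq]
  rw [integral_haarSum_mul hξ, sub_self, partialHaarAutocov, scaleTail_zero_eq ha M]
  simp only [haarAutocorr_zero, mul_one]
  linarith [scaleTail_nonneg a M]

/-- On the windows `A J`, the array `Z J t` is approximated in mean square by finite Haar sums. -/
structure IsHaarApprox (P : Measure Ω) (a : ℕ → ℝ) (ξ : ℕ → ℤ → Ω → ℝ) (A : ℕ → Finset ℤ)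
    (Z : ℕ → ℤ → Ω → ℝ) : Prop where
  memLp : ∀ J, ∀ t ∈ A J, MemLp (Z J t) 2 P
  approx : ∀ ε > 0, ∀ᶠ M in atTop, ∀ᶠ J in atTop, ∀ t ∈ A J,
    ∫ ω, (Z J t ω - haarSum a ξ M t ω) ^ 2 ∂P ≤ ε

variable {A : ℕ → Finset ℤ} {Z : ℕ → ℤ → Ω → ℝ}

/-- Two errors of at most ε/2 each: replacing `Z` by a Haar sum over `M` scales, and replacing the
autocovariance of that sum by its limit. Both are uniform over the window. -/
theorem IsHaarApprox.abs_cov_sub_le (hξ : IsOrthonormalArray P ξ) (ha : Summable fun j => a j ^ 2)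
    (hZ : IsHaarApprox P a ξ A Z) {ε : ℝ} (hε : 0 < ε) :
    ∀ᶠ J in atTop, ∀ t ∈ A J, ∀ s ∈ A J,
      |∫ ω, Z J t ω * Z J s ω ∂P - haarAutocov a (s - t)| ≤ ε := by
  set G := √(scaleTail a 0)
  have hG : 0 ≤ G := Real.sqrt_nonneg _
  have hG2 : G ^ 2 = scaleTail a 0 := Real.sq_sqrt (scaleTail_nonneg a 0)
  set η := min 1 (ε / 2 / (1 + 2 * G))
  have hη : 0 < η := lt_min one_pos (by positivity)
  have hη1 : η ≤ 1 := min_le_left _ _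
  have hη2 : η * (1 + 2 * G) ≤ ε / 2 := by
    rw [← le_div_iff₀ (by positivity)]
    exact min_le_right _ _
  obtain ⟨M, hM, hM'⟩ := ((hZ.approx (η ^ 2) (by positivity)).and
    ((tendsto_scaleTail a).eventually_le_const (half_pos hε))).exists
  filter_upwards [hM] with J hJ t ht s hs
  -- The Haar sums are taken as the reference pair because their second moments are at most `G ^ 2`
  -- for every `M`.
  have h1 := integral_abs_mul_sub_mul_le (memLp_haarSum hξ a M t) (memLp_haarSum hξ a M s)
    (hZ.memLp J t ht) (hZ.memLp J s hs) hη.le hG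
    (by simpa only [sub_sq_comm] using hJ t ht) (by simpa only [sub_sq_comm] using hJ s hs)
    (by rw [hG2]; exact integral_haarSum_sq_le hξ ha M t)
    (by rw [hG2]; exact integral_haarSum_sq_le hξ ha M s)
  have h2 : |partialHaarAutocov a M (s - t) - ∫ ω, Z J t ω * Z J s ω ∂P| ≤ η * (η + 2 * G) := by
    rw [← integral_haarSum_mul hξ, ← integral_sub]
    · exact abs_integral_le_integral_abs.trans h1
    · exact (memLp_haarSum hξ a M t).integrable_mul (memLp_haarSum hξ a M s)
    · exact (hZ.memLp J t ht).integrable_mul (hZ.memLp J s hs)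
  have h3 := abs_haarAutocov_sub_le ha M (s - t)
  have h4 : η * (η + 2 * G) ≤ ε / 2 :=
    (mul_le_mul_of_nonneg_left (by linarith) hη.le).trans hη2
  rw [abs_sub_comm] at h2 h3
  rw [abs_le] at *
  constructor <;> linarith [h2.1, h2.2, h3.1, h3.2]

end

/-! ### Averages and sample autocovariances of weakly correlated arrays. -/

noncomputable section

variable {Ω : Type*} [MeasurableSpace Ω] {P : Measure Ω}

/-- A second moment bound for averages of weakly correlated random variables. -/
theorem integral_average_sq_le {B : Finset ℤ} {V : ℤ → Ω → ℝ} {n η β : ℝ} {m : ℕ}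
    (hn : 0 < n) (hB : (B.card : ℝ) ≤ n) (hη : 0 ≤ η) (hβ : 0 ≤ β) (hV : ∀ t ∈ B, MemLp (V t) 2 P)
    (hcov : ∀ t ∈ B, ∀ s ∈ B,
      |∫ ω, V t ω * V s ω ∂P| ≤ η + if |t - s| ≤ m then β else 0) :
    ∫ ω, ((∑ t ∈ B, V t ω) / n) ^ 2 ∂P ≤ η + β * (2 * m + 1) / n := by
  have hint : ∀ t ∈ B, ∀ s ∈ B, Integrable (fun ω => V t ω * V s ω) P := fun t ht s hs =>
    (hV t ht).integrable_mul (hV s hs)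
  have h1 : ∫ ω, ((∑ t ∈ B, V t ω) / n) ^ 2 ∂P
      = (∑ t ∈ B, ∑ s ∈ B, ∫ ω, V t ω * V s ω ∂P) / n ^ 2 := by
    simp only [div_pow]
    rw [integral_div]
    congr 1
    simp only [sq, Finset.sum_mul_sum]
    rw [integral_finsetSum _ fun p hp => integrable_finsetSum _ fun q hq => hint p hp q hq]
    exact Finset.sum_congr rfl fun t ht => integral_finsetSum _ fun q hq => hint t ht q hq
  -- In each row of the covariance matrix at most 2m + 1 entries lie in the band where `β` counts.
  have h2 : ∀ t ∈ B, ∑ s ∈ B, ∫ ω, V t ω * V s ω ∂P ≤ n * η + β * (2 * m + 1) := by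
    intro t ht
    calc ∑ s ∈ B, ∫ ω, V t ω * V s ω ∂P
        ≤ ∑ s ∈ B, (η + if |t - s| ≤ m then β else 0) :=
          Finset.sum_le_sum fun s hs => (le_abs_self _).trans (hcov t ht s hs)
      _ = B.card * η + ∑ s ∈ B with |t - s| ≤ m, β := by
          rw [Finset.sum_add_distrib, Finset.sum_const, nsmul_eq_mul, Finset.sum_filter]
      _ ≤ n * η + β * (2 * m + 1) := by
          refine add_le_add (mul_le_mul_of_nonneg_right hB hη) ?_
          rw [Finset.sum_const, nsmul_eq_mul, mul_comm]
          refine mul_le_mul_of_nonneg_left ?_ hβ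
          have hsub : (B.filter fun s => |t - s| ≤ m) ⊆ Finset.Icc (t - m) (t + m) := by
            intro s hs
            have := abs_le.1 (Finset.mem_filter.1 hs).2
            rw [Finset.mem_Icc]
            omega
          have hcard := Finset.card_le_card hsub
          rw [Int.card_Icc] at hcard
          have : (B.filter fun s => |t - s| ≤ m).card ≤ 2 * m + 1 := by omega
          exact_mod_cast this
  rw [h1, div_le_iff₀ (by positivity)]
  calc ∑ t ∈ B, ∑ s ∈ B, ∫ ω, V t ω * V s ω ∂P
      ≤ ∑ _t ∈ B, (n * η + β * (2 * m + 1)) := Finset.sum_le_sum h2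
    _ = B.card * (n * η + β * (2 * m + 1)) := by rw [Finset.sum_const, nsmul_eq_mul]
    _ ≤ n * (n * η + β * (2 * m + 1)) := mul_le_mul_of_nonneg_right hB (by positivity)
    _ = (η + β * (2 * m + 1) / n) * n ^ 2 := by field_simp

/-- The covariances of `V J t`, `t ∈ B J`, are uniformly small away from the diagonal. -/
def IsWeaklyCorrelated (P : Measure Ω) (B : ℕ → Finset ℤ) (V : ℕ → ℤ → Ω → ℝ) : Prop :=
  ∀ ε > 0, ∃ (m : ℕ) (β : ℝ), 0 ≤ β ∧ ∀ᶠ J in atTop, ∀ t ∈ B J, ∀ s ∈ B J,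
    |∫ ω, V J t ω * V J s ω ∂P| ≤ ε + if |t - s| ≤ m then β else 0

variable {A B : ℕ → Finset ℤ} {V Z : ℕ → ℤ → Ω → ℝ}

/-- The band of large covariances has bounded width, so its share is of order 1/n. The sum runs over
a subset `B J` of the window to cover the times `t` for which `t + h` is observed too. -/
theorem tendsto_integral_average_sq
    (hA : Tendsto (fun J => ((A J).card : ℝ)) atTop atTop) (hBA : ∀ J, B J ⊆ A J)
    (hV : ∀ J, ∀ t ∈ B J, MemLp (V J t) 2 P) (hcov : IsWeaklyCorrelated P B V) :
    Tendsto (fun J => ∫ ω, ((∑ t ∈ B J, V J t ω) / (A J).card) ^ 2 ∂P) atTop (𝓝 0) := by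
  rw [Metric.tendsto_nhds]
  intro ε hε
  obtain ⟨m, β, hβ, h⟩ := hcov (ε / 4) (by positivity)
  have hlim : Tendsto (fun J => β * (2 * m + 1) / ((A J).card : ℝ)) atTop (𝓝 0) :=
    tendsto_const_nhds.div_atTop hA
  filter_upwards [h, hlim.eventually_le_const (show 0 < ε / 4 by positivity),
    hA.eventually_gt_atTop 0] with J hJ hJ' hpos
  have h1 := integral_average_sq_le hpos (by exact_mod_cast Finset.card_le_card (hBA J))
    (by positivity) hβ (hV J) hJ
  rw [Real.dist_0_eq_abs, abs_of_nonneg (integral_nonneg fun _ => sq_nonneg _)]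
  linarith

theorem sampleAutocov_eq (A : Finset ℤ) (x : ℤ → ℝ) (h : ℕ) :
    sampleAutocov A x h = (∑ t ∈ A with t + (h : ℤ) ∈ A, x (t + h) * x t) / A.card
      - sampleMean A x * ((∑ t ∈ A with t + (h : ℤ) ∈ A, (x (t + h) + x t)) / A.card)
      + ((A.filter fun t => t + (h : ℤ) ∈ A).card : ℝ) / A.card * sampleMean A x ^ 2 := by
  have : ∑ t ∈ A with t + (h : ℤ) ∈ A, (x (t + h) - sampleMean A x) * (x t - sampleMean A x)
      = ∑ t ∈ A with t + (h : ℤ) ∈ A, x (t + h) * x t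
        - sampleMean A x * ∑ t ∈ A with t + (h : ℤ) ∈ A, (x (t + h) + x t)
        + ((A.filter fun t => t + (h : ℤ) ∈ A).card : ℝ) * sampleMean A x ^ 2 := by
    rw [Finset.mul_sum, ← Finset.sum_sub_distrib, ← nsmul_eq_mul, ← Finset.sum_const,
      ← Finset.sum_add_distrib]
    exact Finset.sum_congr rfl fun t _ => by ring
  rw [sampleAutocov, this]
  ring

/-- Apart from the average of lagged products, every term of the expansion carries a factor
`sampleMean`, which will be negligible. -/
theorem abs_sampleAutocov_sub_le (A : Finset ℤ) (x : ℤ → ℝ) (h : ℕ) (c : ℝ) :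
    |sampleAutocov A x h - c| ≤ |(∑ t ∈ A with t + (h : ℤ) ∈ A, x (t + h) * x t) / A.card - c|
      + |sampleMean A x * ((∑ t ∈ A with t + (h : ℤ) ∈ A, (x (t + h) + x t)) / A.card)|
      + sampleMean A x ^ 2 := by
  rw [sampleAutocov_eq]
  have h1 : ((A.filter fun t => t + (h : ℤ) ∈ A).card : ℝ) / A.card ≤ 1 :=
    div_le_one_of_le₀ (by exact_mod_cast Finset.card_filter_le _ _) (by positivity)
  have h2 : 0 ≤ ((A.filter fun t => t + (h : ℤ) ∈ A).card : ℝ) / A.card := by positivity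
  set r := ((A.filter fun t => t + (h : ℤ) ∈ A).card : ℝ) / A.card
  have h3 : r * sampleMean A x ^ 2 ≤ sampleMean A x ^ 2 :=
    mul_le_of_le_one_left (sq_nonneg _) h1
  have h4 : 0 ≤ r * sampleMean A x ^ 2 := mul_nonneg h2 (sq_nonneg _)
  generalize (∑ t ∈ A with t + (h : ℤ) ∈ A, x (t + h) * x t) / (A.card : ℝ) = S
  generalize sampleMean A x * ((∑ t ∈ A with t + (h : ℤ) ∈ A, (x (t + h) + x t)) / A.card) = R
  have := le_abs_self (S - c)
  have := neg_abs_le (S - c)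
  have := le_abs_self R
  have := neg_abs_le R
  rw [abs_le]
  constructor <;> linarith

theorem memLp_sampleMean {A : Finset ℤ} {Z : ℤ → Ω → ℝ} (hZ : ∀ t ∈ A, MemLp (Z t) 2 P) :
    MemLp (fun ω => sampleMean A fun t => Z t ω) 2 P := by
  simp only [sampleMean, div_eq_mul_inv]
  exact (memLp_finsetSum _ hZ).mul_const _

/-- If products at lag `h` obey a law of large numbers in mean, so do sample autocovariances of
a weakly correlated array. -/
theorem tendsto_integral_abs_sampleAutocov_sub
    (hA : Tendsto (fun J => ((A J).card : ℝ)) atTop atTop)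
    (hZ : ∀ J, ∀ t ∈ A J, MemLp (Z J t) 2 P) (hcov : IsWeaklyCorrelated P A Z) (h : ℕ) (c : ℝ)
    (hprod : Tendsto (fun J => ∫ ω, |(∑ t ∈ A J with t + (h : ℤ) ∈ A J,
      Z J (t + h) ω * Z J t ω) / (A J).card - c| ∂P) atTop (𝓝 0)) [IsProbabilityMeasure P] :
    Tendsto (fun J => ∫ ω, |sampleAutocov (A J) (fun t => Z J t ω) h - c| ∂P) atTop (𝓝 0) := by
  have hmean : Tendsto (fun J => ∫ ω, (sampleMean (A J) fun t => Z J t ω) ^ 2 ∂P) atTop (𝓝 0) :=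
    tendsto_integral_average_sq hA (fun _ => Finset.Subset.refl _) hZ hcov
  have hbdd : ∃ G : ℝ, 0 ≤ G ∧ ∀ᶠ J in atTop, ∀ t ∈ A J, ∫ ω, Z J t ω ^ 2 ∂P ≤ G ^ 2 := by
    obtain ⟨m, β, hβ, hm⟩ := hcov 1 one_pos
    refine ⟨√(1 + β), Real.sqrt_nonneg _, hm.mono fun J hJ t ht => ?_⟩
    have := (le_abs_self _).trans (hJ t ht t ht)
    rw [Real.sq_sqrt (by positivity)]
    simpa [sq] using this
  obtain ⟨G, hG, hbdd⟩ := hbdd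
  set R : ℕ → Ω → ℝ := fun J ω =>
    (∑ t ∈ A J with t + (h : ℤ) ∈ A J, (Z J (t + h) ω + Z J t ω)) / (A J).card with hR
  set xbar : ℕ → Ω → ℝ := fun J ω => sampleMean (A J) fun t => Z J t ω with hxbar
  have hxm : ∀ J, MemLp (xbar J) 2 P := fun J => memLp_sampleMean (hZ J)
  have hu : ∀ J, ∀ t ∈ (A J).filter fun t => t + (h : ℤ) ∈ A J,
      MemLp (fun ω => Z J (t + h) ω + Z J t ω) 2 P := fun J t ht =>
    (hZ J _ (Finset.mem_filter.1 ht).2).add (hZ J _ (Finset.mem_filter.1 ht).1)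
  have hRm : ∀ J, MemLp (R J) 2 P := by
    intro J
    simp only [hR, div_eq_mul_inv]
    exact (memLp_finsetSum _ (hu J)).mul_const _
  have hRb : ∀ᶠ J in atTop, ∫ ω, R J ω ^ 2 ∂P ≤ (2 * G) ^ 2 := by
    filter_upwards [hbdd, hA.eventually_gt_atTop 0] with J hJ hpos
    have hu2 : ∀ t ∈ (A J).filter fun t => t + (h : ℤ) ∈ A J,
        ∫ ω, (Z J (t + h) ω + Z J t ω) ^ 2 ∂P ≤ (2 * G) ^ 2 := by
      intro t ht
      have m1 := hZ J _ (Finset.mem_filter.1 ht).2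
      have m2 := hZ J _ (Finset.mem_filter.1 ht).1
      have b1 := hJ _ (Finset.mem_filter.1 ht).2
      have b2 := hJ _ (Finset.mem_filter.1 ht).1
      calc ∫ ω, (Z J (t + h) ω + Z J t ω) ^ 2 ∂P
          ≤ ∫ ω, (2 * Z J (t + h) ω ^ 2 + 2 * Z J t ω ^ 2) ∂P := by
            refine integral_mono (hu J t ht).integrable_sq
              ((m1.integrable_sq.const_mul 2).add (m2.integrable_sq.const_mul 2)) fun ω => ?_
            simp only
            nlinarith [sq_nonneg (Z J (t + h) ω - Z J t ω)]
        _ = 2 * ∫ ω, Z J (t + h) ω ^ 2 ∂P + 2 * ∫ ω, Z J t ω ^ 2 ∂P := by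
            rw [integral_add (m1.integrable_sq.const_mul 2) (m2.integrable_sq.const_mul 2),
              integral_const_mul, integral_const_mul]
        _ ≤ (2 * G) ^ 2 := by linarith
    -- Here boundedness suffices: all covariances are put into `η` by Cauchy–Schwarz and the band is
    -- empty of content. Smallness of the cross term comes from its factor `xbar`.
    have := integral_average_sq_le (B := (A J).filter fun t => t + (h : ℤ) ∈ A J)
      (V := fun t ω => Z J (t + h) ω + Z J t ω) (η := (2 * G) ^ 2) (β := 0) (m := 0) hpos
      (by exact_mod_cast Finset.card_filter_le _ _) (by positivity) le_rfl (hu J) fun t ht s hs => by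
        simp only [ite_self, add_zero]
        rw [sq (2 * G)]
        exact abs_integral_mul_le_of_sq_le (hu J t ht) (hu J s hs) (by positivity) (by positivity)
          (hu2 t ht) (hu2 s hs)
    simpa using this
  have hcross : ∀ᶠ J in atTop, ∫ ω, |xbar J ω * R J ω| ∂P
      ≤ √(∫ ω, xbar J ω ^ 2 ∂P) * (2 * G) := by
    filter_upwards [hRb] with J hJ
    refine integral_abs_mul_le_of_sq_le (hxm J) (hRm J) (Real.sqrt_nonneg _) (by positivity) ?_ hJ
    rw [Real.sq_sqrt (integral_nonneg fun _ => sq_nonneg _)]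
  have hlim := (hprod.add ((hmean.sqrt).mul_const (2 * G))).add hmean
  simp only [Real.sqrt_zero, zero_mul, add_zero] at hlim
  refine tendsto_of_tendsto_of_tendsto_of_le_of_le' tendsto_const_nhds hlim
    (Eventually.of_forall fun J => integral_nonneg fun _ => abs_nonneg _) ?_
  filter_upwards [hcross] with J hJ
  have i1 : Integrable (fun ω => |(∑ t ∈ A J with t + (h : ℤ) ∈ A J,
      Z J (t + h) ω * Z J t ω) / (A J).card - c|) P := by
    refine (((integrable_finsetSum _ fun t ht => ?_).div_const _).sub (integrable_const c)).abs
    exact (hZ J _ (Finset.mem_filter.1 ht).2).integrable_mul (hZ J _ (Finset.mem_filter.1 ht).1)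
  have i2 : Integrable (fun ω => |xbar J ω * R J ω|) P := ((hxm J).integrable_mul (hRm J)).abs
  have i3 : Integrable (fun ω => xbar J ω ^ 2) P := (hxm J).integrable_sq
  refine (integral_mono_of_nonneg (Eventually.of_forall fun ω => abs_nonneg _)
    ((i1.add i2).add i3) (Eventually.of_forall fun ω =>
      abs_sampleAutocov_sub_le (A J) (fun t => Z J t ω) h c)).trans ?_
  refine ((integral_add (i1.add i2) i3).trans
    (congrArg (· + _) (integral_add i1 i2))).le.trans ?_
  exact add_le_add (add_le_add le_rfl hJ) le_rfl

/-- Covariances are within ε/2 of `haarAutocov`, which is below ε/2 at long lags and at most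
`scaleTail a 0` everywhere. -/
theorem IsHaarApprox.isWeaklyCorrelated {a : ℕ → ℝ} {ξ : ℕ → ℤ → Ω → ℝ}
    (hξ : IsOrthonormalArray P ξ) (ha : Summable fun j => a j ^ 2)
    (hZ : IsHaarApprox P a ξ A Z) : IsWeaklyCorrelated P A Z := by
  intro ε hε
  obtain ⟨m, hm⟩ := exists_abs_haarAutocov_le ha (half_pos hε)
  refine ⟨m, scaleTail a 0, scaleTail_nonneg a 0, ?_⟩
  filter_upwards [hZ.abs_cov_sub_le hξ ha (half_pos hε)] with J hJ t ht s hs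
  have h1 := hJ t ht s hs
  have h2 : |∫ ω, Z J t ω * Z J s ω ∂P| ≤ ε / 2 + |haarAutocov a (s - t)| := by
    have := abs_sub_abs_le_abs_sub (∫ ω, Z J t ω * Z J s ω ∂P) (haarAutocov a (s - t))
    linarith
  split_ifs with hts
  · have := abs_haarAutocov_le ha (s - t)
    linarith
  · have := hm (s - t) (by rw [abs_sub_comm]; omega)
    linarith

end

/-! ### Gaussian fourth moments and the law of large numbers for X. -/

noncomputable section

variable {Ω : Type*} [MeasurableSpace Ω] {P : Measure Ω}

/-- The fourth moment is the fourth derivative at 0 of the moment generating function exp(vt²/2). -/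
theorem integral_pow_four_gaussianReal (v : ℝ≥0) :
    ∫ x, x ^ 4 ∂(gaussianReal 0 v) = 3 * (v : ℝ) ^ 2 := by
  have hint : (0 : ℝ) ∈ interior (integrableExpSet (fun x : ℝ => x) (gaussianReal 0 v)) := by
    have := integrableExpSet_id_gaussianReal (μ := 0) (v := v)
    change (0 : ℝ) ∈ interior (integrableExpSet id (gaussianReal 0 v))
    simp [this]
  have h := iteratedDeriv_mgf_zero hint 4
  rw [mgf_fun_id_gaussianReal] at h
  refine h.symm.trans ?_
  set e : ℝ → ℝ := fun t => Real.exp (0 * t + v * t ^ 2 / 2)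
  have he : ∀ t, HasDerivAt e (v * t * e t) t := by
    intro t
    have := ((((hasDerivAt_id t).const_mul 0).add
      (((hasDerivAt_pow 2 t).const_mul (v : ℝ)).div_const 2))).exp
    refine this.congr_deriv ?_
    simp [e]
    ring
  -- Derivatives of `e` are polynomials times `e`. Cubic polynomials suffice as input, since the
  -- third derivative has degree three.
  have hp : ∀ (c d f g : ℝ), deriv (fun t => (c + d * t + f * t ^ 2 + g * t ^ 3) * e t)
      = fun t => (d + (2 * f + v * c) * t + (3 * g + v * d) * t ^ 2 + v * f * t ^ 3
        + v * g * t ^ 4) * e t := by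
    intro c d f g
    funext t
    have h1 : HasDerivAt (fun t : ℝ => c + d * t + f * t ^ 2 + g * t ^ 3)
        (d + 2 * f * t + 3 * g * t ^ 2) t := by
      have := ((((hasDerivAt_id t).const_mul d).const_add c).add
        ((hasDerivAt_pow 2 t).const_mul f)).add ((hasDerivAt_pow 3 t).const_mul g)
      refine this.congr_deriv ?_
      simp
      ring
    refine (h1.mul (he t)).deriv.trans ?_
    ring
  have h0 : e = fun t => (1 + 0 * t + 0 * t ^ 2 + 0 * t ^ 3) * e t := by funext t; ring
  have h1 : deriv e = fun t => (0 + v * t + 0 * t ^ 2 + 0 * t ^ 3) * e t := by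
    rw [h0, hp]; funext t; ring
  have h2 : deriv (deriv e) = fun t => (v + 0 * t + v ^ 2 * t ^ 2 + 0 * t ^ 3) * e t := by
    rw [h1, hp]; funext t; ring
  have h3 : deriv (deriv (deriv e)) = fun t => (0 + 3 * v ^ 2 * t + 0 * t ^ 2 + v ^ 3 * t ^ 3) * e t := by
    rw [h2, hp]; funext t; ring
  simp only [iteratedDeriv_succ, iteratedDeriv_zero]
  rw [h3, hp]
  simp [e]

theorem ProbabilityTheory.HasGaussianLaw.integral_pow_four {U : Ω → ℝ} (hU : HasGaussianLaw U P)
    (h0 : ∫ ω, U ω ∂P = 0) : ∫ ω, U ω ^ 4 ∂P = 3 * (∫ ω, U ω ^ 2 ∂P) ^ 2 := by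
  have hm := hU.aemeasurable
  have h1 := hU.map_eq_gaussianReal
  rw [h0] at h1
  have h2 : ∫ ω, U ω ^ 4 ∂P = ∫ x, x ^ 4 ∂(P.map U) :=
    (integral_map hm (f := fun x : ℝ => x ^ 4) (by fun_prop)).symm
  have h3 : Var[U; P] = ∫ ω, U ω ^ 2 ∂P := variance_of_integral_eq_zero hm h0
  rw [h2, h1, integral_pow_four_gaussianReal, Real.coe_toNNReal _ (variance_nonneg _ _), h3]

theorem ProbabilityTheory.HasGaussianLaw.memLp_sq {U : Ω → ℝ} (hU : HasGaussianLaw U P) :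
    MemLp (fun ω => U ω ^ 2) 2 P := by
  have := hU.isProbabilityMeasure
  have := (hU.memLp (p := 4) (by norm_num)).norm_rpow_div 2
  refine (memLp_congr_ae (Eventually.of_forall fun ω => ?_)).1
    (this.mono_exponent (p := 2) (le_of_eq ?_))
  · simp
  · rw [ENNReal.eq_div_iff (by norm_num) (by norm_num)]
    norm_num

/-- Isserlis' formula by polarization: 12u²v² = (u+v)⁴ + (u-v)⁴ - 2u⁴ - 2v⁴, and each fourth moment
of a centred Gaussian variable is three times its squared variance. -/
theorem integral_sq_mul_sq_of_hasGaussianLaw {U V : Ω → ℝ} (hU : HasGaussianLaw U P)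
    (hV : HasGaussianLaw V P) (hadd : HasGaussianLaw (U + V) P) (hsub : HasGaussianLaw (U - V) P)
    (hU0 : ∫ ω, U ω ∂P = 0) (hV0 : ∫ ω, V ω ∂P = 0) :
    ∫ ω, U ω ^ 2 * V ω ^ 2 ∂P
      = (∫ ω, U ω ^ 2 ∂P) * (∫ ω, V ω ^ 2 ∂P) + 2 * (∫ ω, U ω * V ω ∂P) ^ 2 := by
  have hUi := hU.integrable
  have hVi := hV.integrable
  have i4 : ∀ {Q : Ω → ℝ}, HasGaussianLaw Q P → Integrable (fun ω => Q ω ^ 4) P := fun hQ => by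
    have := (hQ.memLp (p := 4) (by norm_num)).integrable_norm_pow (p := 4) (by norm_num)
    refine this.congr (Eventually.of_forall fun ω => ?_)
    simp only [Real.norm_eq_abs]
    rw [← abs_pow, abs_of_nonneg (by positivity)]
  have iu := hU.memLp_two.integrable_sq
  have iv := hV.memLp_two.integrable_sq
  have iuv2 : Integrable (fun ω => U ω ^ 2 + V ω ^ 2) P := iu.add iv
  have iuv : Integrable (fun ω => U ω * V ω) P := hU.memLp_two.integrable_mul hV.memLp_two
  have ea := hadd.integral_pow_four (by
    simp only [Pi.add_apply]; rw [integral_add hUi hVi, hU0, hV0, add_zero])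
  have es := hsub.integral_pow_four (by
    simp only [Pi.sub_apply]; rw [integral_sub hUi hVi, hU0, hV0, sub_zero])
  have eu := hU.integral_pow_four hU0
  have ev := hV.integral_pow_four hV0
  have sa : ∫ ω, (U + V) ω ^ 2 ∂P
      = ∫ ω, U ω ^ 2 ∂P + ∫ ω, V ω ^ 2 ∂P + 2 * ∫ ω, U ω * V ω ∂P := by
    rw [← integral_const_mul, ← integral_add iu iv, ← integral_add iuv2 (iuv.const_mul 2)]
    exact integral_congr_ae (Eventually.of_forall fun ω => by simp; ring)
  have ss : ∫ ω, (U - V) ω ^ 2 ∂P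
      = ∫ ω, U ω ^ 2 ∂P + ∫ ω, V ω ^ 2 ∂P - 2 * ∫ ω, U ω * V ω ∂P := by
    rw [← integral_const_mul, ← integral_add iu iv, ← integral_sub iuv2 (iuv.const_mul 2)]
    exact integral_congr_ae (Eventually.of_forall fun ω => by simp; ring)
  have key : ∫ ω, U ω ^ 2 * V ω ^ 2 ∂P = (∫ ω, (U + V) ω ^ 4 ∂P + ∫ ω, (U - V) ω ^ 4 ∂P
      - 2 * ∫ ω, U ω ^ 4 ∂P - 2 * ∫ ω, V ω ^ 4 ∂P) / 12 := by
    have e1 : Integrable (fun ω => (U + V) ω ^ 4 + (U - V) ω ^ 4) P := (i4 hadd).add (i4 hsub)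
    have e2 : Integrable (fun ω => (U + V) ω ^ 4 + (U - V) ω ^ 4 - 2 * U ω ^ 4) P :=
      e1.sub ((i4 hU).const_mul 2)
    rw [← integral_const_mul, ← integral_const_mul, ← integral_add (i4 hadd) (i4 hsub),
      ← integral_sub e1 ((i4 hU).const_mul 2), ← integral_sub e2 ((i4 hV).const_mul 2),
      ← integral_div]
    exact integral_congr_ae (Eventually.of_forall fun ω => by simp; ring)
  rw [key, ea, es, eu, ev, sa, ss]
  ring

/-- Four terms are what the sum or difference of two lagged combinations of `Z` requires. -/
theorem ProbabilityTheory.IsGaussianProcess.hasGaussianLaw_four {T : Type*} {Z : T → Ω → ℝ}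
    (hZ : IsGaussianProcess Z P) (t₁ t₂ t₃ t₄ : T) (c₁ c₂ c₃ c₄ : ℝ) :
    HasGaussianLaw (fun ω => c₁ * Z t₁ ω + c₂ * Z t₂ ω + (c₃ * Z t₃ ω + c₄ * Z t₄ ω)) P := by
  classical
  refine (hZ.of_isGaussianProcess (Y := fun (_ : Unit) ω =>
    c₁ * Z t₁ ω + c₂ * Z t₂ ω + (c₃ * Z t₃ ω + c₄ * Z t₄ ω)) fun _ => ⟨{t₁, t₂, t₃, t₄},
      { toFun := fun x => c₁ * x ⟨t₁, by simp⟩ + c₂ * x ⟨t₂, by simp⟩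
          + (c₃ * x ⟨t₃, by simp⟩ + c₄ * x ⟨t₄, by simp⟩)
        map_add' := fun x y => by simp only [Pi.add_apply]; ring
        map_smul' := fun c x => by simp only [Pi.smul_apply, smul_eq_mul, RingHom.id_apply]; ring
        cont := by fun_prop }, fun ω => ?_⟩).hasGaussianLaw_eval ()
  simp

variable {A : ℕ → Finset ℤ} {Z : ℕ → ℤ → Ω → ℝ}

theorem card_filter_add_mem_Icc (b c : ℤ) (h : ℕ) :
    ((Finset.Icc b c).card : ℝ) - h
      ≤ ((Finset.Icc b c).filter fun t => t + (h : ℤ) ∈ Finset.Icc b c).card := by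
  have hsub : Finset.Icc b (c - h) ⊆
      (Finset.Icc b c).filter fun t => t + (h : ℤ) ∈ Finset.Icc b c := by
    intro t ht
    simp only [Finset.mem_filter, Finset.mem_Icc] at ht ⊢
    omega
  have hcard := Finset.card_le_card hsub
  have h1 : (Finset.Icc b c).card ≤ (Finset.Icc b (c - h)).card + h := by
    simp only [Int.card_Icc]
    omega
  have : ((Finset.Icc b c).card : ℝ) ≤ (Finset.Icc b (c - h)).card + h := by exact_mod_cast h1
  have : ((Finset.Icc b (c - h)).card : ℝ) ≤
    ((Finset.Icc b c).filter fun t => t + (h : ℤ) ∈ Finset.Icc b c).card := by exact_mod_cast hcard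
  linarith

/-- Averages over the lagged pairs in a long window inherit the limit of their terms. -/
theorem tendsto_lagged_average (hA : Tendsto (fun J => ((A J).card : ℝ)) atTop atTop)
    (hwin : ∀ᶠ J in atTop, ∃ b c, A J = Finset.Icc b c) (h : ℕ) {e : ℕ → ℤ → ℝ} {g : ℝ}
    (he : ∀ ε > 0, ∀ᶠ J in atTop, ∀ t ∈ A J, t + (h : ℤ) ∈ A J → |e J t - g| ≤ ε) :
    Tendsto (fun J => (∑ t ∈ A J with t + (h : ℤ) ∈ A J, e J t) / (A J).card) atTop (𝓝 g) := by
  rw [Metric.tendsto_nhds]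
  intro ε hε
  have hlim : Tendsto (fun J => (h : ℝ) / ((A J).card : ℝ) * |g|) atTop (𝓝 0) := by
    simpa using ((tendsto_const_nhds (x := (h : ℝ))).div_atTop hA).mul_const |g|
  filter_upwards [hwin, he (ε / 2) (half_pos hε), hA.eventually_gt_atTop 0,
    hlim.eventually_lt_const (half_pos hε)] with J ⟨b, c, hbc⟩ hJ hpos hsmall
  have h1 := card_filter_add_mem_Icc b c h
  rw [← hbc] at h1
  have h2 : (((A J).filter fun t => t + (h : ℤ) ∈ A J).card : ℝ) ≤ (A J).card := by
    exact_mod_cast Finset.card_filter_le _ _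
  set n : ℝ := ((A J).card : ℝ)
  set m : ℝ := (((A J).filter fun t => t + (h : ℤ) ∈ A J).card : ℝ) with hm
  have h3 : |∑ t ∈ A J with t + (h : ℤ) ∈ A J, (e J t - g)| ≤ n * (ε / 2) := by
    refine (Finset.abs_sum_le_sum_abs _ _).trans ((Finset.sum_le_sum fun t ht =>
      hJ t (Finset.mem_filter.1 ht).1 (Finset.mem_filter.1 ht).2).trans ?_)
    rw [Finset.sum_const, nsmul_eq_mul]
    exact mul_le_mul_of_nonneg_right h2 (by positivity)
  -- The second term accounts for the at most `h` times at the right end that have no partner in the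
  -- window.
  have h4 : (∑ t ∈ A J with t + (h : ℤ) ∈ A J, e J t) / n - g
      = (∑ t ∈ A J with t + (h : ℤ) ∈ A J, (e J t - g)) / n - (n - m) / n * g := by
    rw [Finset.sum_sub_distrib, Finset.sum_const, nsmul_eq_mul, ← hm]
    field_simp
    ring
  rw [Real.dist_eq, h4]
  refine (abs_sub _ _).trans_lt ?_
  have h5 : |(∑ t ∈ A J with t + (h : ℤ) ∈ A J, (e J t - g)) / n| ≤ ε / 2 := by
    rw [abs_div, abs_of_pos hpos, div_le_iff₀ hpos]
    linarith
  have h6 : |(n - m) / n * g| ≤ h / n * |g| := by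
    rw [abs_mul, abs_div, abs_of_pos hpos, abs_of_nonneg (show 0 ≤ n - m by linarith)]
    gcongr
    linarith
  linarith

/-- Squares of a two-term combination of a weakly correlated Gaussian array are weakly correlated
after centring. -/
theorem isWeaklyCorrelated_gaussian_sq (hG : ∀ J, IsGaussianProcess (fun t : A J => Z J t) P)
    (hmean : ∀ J, ∀ t ∈ A J, ∫ ω, Z J t ω ∂P = 0) (hcov : IsWeaklyCorrelated P A Z) (h : ℕ)
    {e : ℝ} (he : |e| ≤ 1) :
    IsWeaklyCorrelated P (fun J => (A J).filter fun t => t + (h : ℤ) ∈ A J) (fun J t ω =>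
      (Z J (t + h) ω + e * Z J t ω) ^ 2 - ∫ ω', (Z J (t + h) ω' + e * Z J t ω') ^ 2 ∂P) := by
  intro ε hε
  have hPr : IsProbabilityMeasure P := (hG 0).isProbabilityMeasure
  -- The covariance below will be 2(∫UV)² ≤ 32(δ + d)². With δ ≤ 1 this is at most 32δ + 32(2d +
  -- d²), which explains ε/32 and the new band height.
  set δ := min 1 (ε / 32)
  have hδ : 0 < δ := lt_min one_pos (by positivity)
  have hδ1 : δ ≤ 1 := min_le_left _ _
  have hδ2 : δ ≤ ε / 32 := min_le_right _ _
  obtain ⟨m, β, hβ, hm⟩ := hcov δ hδ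
  -- The four time differences entering ∫UV differ from t - s by at most h, so the band widens by h.
  refine ⟨m + h, 32 * (2 * β + β ^ 2), by positivity, ?_⟩
  filter_upwards [hm] with J hJ t ht s hs
  obtain ⟨ht0, hth⟩ := Finset.mem_filter.1 ht
  obtain ⟨hs0, hsh⟩ := Finset.mem_filter.1 hs
  set U : Ω → ℝ := fun ω => Z J (t + h) ω + e * Z J t ω with hU
  set V : Ω → ℝ := fun ω => Z J (s + h) ω + e * Z J s ω with hV
  have hlaw := fun c₁ c₂ c₃ c₄ => (hG J).hasGaussianLaw_four ⟨t + h, hth⟩ ⟨t, ht0⟩ ⟨s + h, hsh⟩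
    ⟨s, hs0⟩ c₁ c₂ c₃ c₄
  have lU : HasGaussianLaw U P := by
    convert hlaw 1 e 0 0 using 2
    simp [hU]
  have lV : HasGaussianLaw V P := by
    convert hlaw 0 0 1 e using 2
    simp [hV]
  have ladd : HasGaussianLaw (U + V) P := by
    convert hlaw 1 e 1 e using 2
    simp [hU, hV]
  have lsub : HasGaussianLaw (U - V) P := by
    convert hlaw 1 e (-1) (-e) using 2
    simp [hU, hV]
    ring
  have l2 : ∀ r ∈ A J, MemLp (Z J r) 2 P := fun r hr =>
    ((hG J).hasGaussianLaw_eval ⟨r, hr⟩).memLp_two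
  have i1 : ∀ r ∈ A J, Integrable (Z J r) P := fun r hr => (l2 r hr).integrable (by norm_num)
  have mU : ∀ r ∈ A J, r + (h : ℤ) ∈ A J → ∫ ω, (Z J (r + h) ω + e * Z J r ω) ∂P = 0 := by
    intro r hr hrh
    rw [integral_add (i1 _ hrh) ((i1 _ hr).const_mul e), integral_const_mul, hmean J _ hr,
      hmean J _ hrh]
    simp
  have hI := integral_sq_mul_sq_of_hasGaussianLaw lU lV ladd lsub (mU t ht0 hth) (mU s hs0 hsh)
  have iU := lU.memLp_two.integrable_sq
  have iV := lV.memLp_two.integrable_sq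
  have iUV : Integrable (fun ω => U ω ^ 2 * V ω ^ 2) P := by
    exact lU.memLp_sq.integrable_mul lV.memLp_sq
  have hcentre : ∫ ω, (U ω ^ 2 - ∫ ω', U ω' ^ 2 ∂P) * (V ω ^ 2 - ∫ ω', V ω' ^ 2 ∂P) ∂P
      = 2 * (∫ ω, U ω * V ω ∂P) ^ 2 := by
    set u := ∫ ω', U ω' ^ 2 ∂P with hu
    set v := ∫ ω', V ω' ^ 2 ∂P with hv
    have e1 : ∀ ω, (U ω ^ 2 - u) * (V ω ^ 2 - v)
        = U ω ^ 2 * V ω ^ 2 - v * U ω ^ 2 - u * V ω ^ 2 + u * v := fun ω => by ring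
    have j1 : Integrable (fun ω => U ω ^ 2 * V ω ^ 2 - v * U ω ^ 2) P := iUV.sub (iU.const_mul v)
    have j2 : Integrable (fun ω => U ω ^ 2 * V ω ^ 2 - v * U ω ^ 2 - u * V ω ^ 2) P :=
      j1.sub (iV.const_mul u)
    simp only [e1]
    rw [integral_add j2 (integrable_const _), integral_sub j1 (iV.const_mul u),
      integral_sub iUV (iU.const_mul v), integral_const_mul, integral_const_mul, hI, ← hu, ← hv]
    simp
    ring
  rw [hcentre]
  set d : ℝ := if |t - s| ≤ (m + h : ℕ) then β else 0 with hd
  have hd0 : 0 ≤ d := by rw [hd]; split_ifs <;> simp [hβ]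
  have hpair : ∀ r ∈ A J, ∀ q ∈ A J, |r - q - (t - s)| ≤ h →
      |∫ ω, Z J r ω * Z J q ω ∂P| ≤ δ + d := by
    intro r hr q hq hrq
    refine (hJ r hr q hq).trans (add_le_add le_rfl ?_)
    rw [hd]
    by_cases h1 : |r - q| ≤ m
    · rw [if_pos h1, if_pos]
      have := abs_sub_abs_le_abs_sub (t - s) (r - q)
      rw [abs_sub_comm (t - s) (r - q)] at this
      push_cast
      omega
    · rw [if_neg h1]
      split_ifs <;> simp [hβ]
  have hUV : |∫ ω, U ω * V ω ∂P| ≤ 4 * (δ + d) := by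
    have p1 := (l2 _ hth).integrable_mul (l2 _ hsh)
    have p2 := ((l2 _ hth).integrable_mul (l2 _ hs0)).const_mul e
    have p3 := ((l2 _ ht0).integrable_mul (l2 _ hsh)).const_mul e
    have p4 := ((l2 _ ht0).integrable_mul (l2 _ hs0)).const_mul (e * e)
    have : ∫ ω, U ω * V ω ∂P = ∫ ω, (Z J (t + h) * Z J (s + h)) ω ∂P
        + e * ∫ ω, (Z J (t + h) * Z J s) ω ∂P + e * ∫ ω, (Z J t * Z J (s + h)) ω ∂P
        + e * e * ∫ ω, (Z J t * Z J s) ω ∂P := by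
      rw [← integral_const_mul, ← integral_const_mul, ← integral_const_mul,
        ← integral_add p1 p2]
      refine Eq.trans ?_ ((integral_add ((p1.add p2).add p3) p4).trans
        (congrArg (· + _) (integral_add (p1.add p2) p3)))
      refine integral_congr_ae (Eventually.of_forall fun ω => ?_)
      simp [hU, hV]
      ring
    rw [this]
    have q1 := hpair _ hth _ hsh (by simp)
    have q2 := hpair _ hth _ hs0 (by simp)
    have q3 := hpair _ ht0 _ hsh (by
      rw [show t - (s + (h : ℤ)) - (t - s) = -(h : ℤ) by ring]; simp)
    have q4 := hpair _ ht0 _ hs0 (by simp)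
    have hmul : ∀ {x y : ℝ}, |x| ≤ 1 → |y| ≤ δ + d → |x * y| ≤ δ + d := by
      intro x y hx hy
      rw [abs_mul]
      exact (mul_le_of_le_one_left (abs_nonneg _) hx).trans hy
    have he2 : |e * e| ≤ 1 := by
      rw [abs_mul]
      exact mul_le_one₀ he (abs_nonneg _) he
    refine (abs_add_le _ _).trans ?_
    have r1 := abs_add_le (∫ ω, (Z J (t + h) * Z J (s + h)) ω ∂P
        + e * ∫ ω, (Z J (t + h) * Z J s) ω ∂P) (e * ∫ ω, (Z J t * Z J (s + h)) ω ∂P)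
    have r2 := abs_add_le (∫ ω, (Z J (t + h) * Z J (s + h)) ω ∂P)
        (e * ∫ ω, (Z J (t + h) * Z J s) ω ∂P)
    have r3 := hmul he q2
    have r4 := hmul he q3
    have r5 := hmul he2 q4
    simp only [Pi.mul_apply] at *
    linarith
  rw [abs_of_nonneg (by positivity)]
  have hsq : (∫ ω, U ω * V ω ∂P) ^ 2 ≤ (4 * (δ + d)) ^ 2 := by
    rw [← sq_abs]
    exact pow_le_pow_left₀ (abs_nonneg _) hUV 2
  have hdd : 32 * (2 * d + d ^ 2) = if |t - s| ≤ (m + h : ℕ) then 32 * (2 * β + β ^ 2) else 0 := by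
    rw [hd]
    split_ifs <;> simp
  rw [← hdd]
  have k1 : δ ^ 2 ≤ δ := by nlinarith
  have k2 : δ * d ≤ d := mul_le_of_le_one_left hd0 hδ1
  nlinarith

/-- The law of large numbers for lagged products of a weakly correlated Gaussian array. -/
theorem tendsto_integral_abs_lagged_products_gaussian
    (hA : Tendsto (fun J => ((A J).card : ℝ)) atTop atTop)
    (hwin : ∀ᶠ J in atTop, ∃ b c, A J = Finset.Icc b c)
    (hG : ∀ J, IsGaussianProcess (fun t : A J => Z J t) P)
    (hmean : ∀ J, ∀ t ∈ A J, ∫ ω, Z J t ω ∂P = 0) (hcov : IsWeaklyCorrelated P A Z) (h : ℕ)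
    {g : ℝ} (hg : ∀ ε > 0, ∀ᶠ J in atTop, ∀ t ∈ A J, t + (h : ℤ) ∈ A J →
      |∫ ω, Z J (t + h) ω * Z J t ω ∂P - g| ≤ ε) :
    Tendsto (fun J => ∫ ω, |(∑ t ∈ A J with t + (h : ℤ) ∈ A J,
      Z J (t + h) ω * Z J t ω) / (A J).card - g| ∂P) atTop (𝓝 0) := by
  have hPr : IsProbabilityMeasure P := (hG 0).isProbabilityMeasure
  -- Lagged products are recovered from the squares with e = 1 and e = -1 through 4xy = (x + y)² -
  -- (x - y)².
  set V : ℝ → ℕ → ℤ → Ω → ℝ := fun e J t ω =>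
    (Z J (t + h) ω + e * Z J t ω) ^ 2 - ∫ ω', (Z J (t + h) ω' + e * Z J t ω') ^ 2 ∂P with hV
  have hVm : ∀ e J, ∀ t ∈ (A J).filter fun t => t + (h : ℤ) ∈ A J, MemLp (V e J t) 2 P := by
    intro e J t ht
    obtain ⟨ht0, hth⟩ := Finset.mem_filter.1 ht
    refine MemLp.sub ?_ (memLp_const _)
    have lU : HasGaussianLaw (fun ω => Z J (t + h) ω + e * Z J t ω) P := by
      have := (hG J).hasGaussianLaw_four ⟨t + h, hth⟩ ⟨t, ht0⟩ ⟨t, ht0⟩ ⟨t, ht0⟩ 1 e 0 0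
      simpa using this
    exact lU.memLp_sq
  set avg : ℝ → ℕ → Ω → ℝ := fun e J ω =>
    (∑ t ∈ A J with t + (h : ℤ) ∈ A J, V e J t ω) / (A J).card with havg
  have havgm : ∀ e J, MemLp (avg e J) 2 P := by
    intro e J
    simp only [havg, div_eq_mul_inv]
    exact (memLp_finsetSum _ (hVm e J)).mul_const _
  have hlim : ∀ e, |e| ≤ 1 → Tendsto (fun J => ∫ ω, |avg e J ω| ∂P) atTop (𝓝 0) := by
    intro e he
    have h1 := (tendsto_integral_average_sq hA (fun J => Finset.filter_subset _ _) (hVm e)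
      (isWeaklyCorrelated_gaussian_sq hG hmean hcov h he)).sqrt
    rw [Real.sqrt_zero] at h1
    refine squeeze_zero (fun _ => integral_nonneg fun _ => abs_nonneg _) (fun J => ?_) h1
    refine integral_abs_le_of_sq_le (havgm e J) (Real.sqrt_nonneg _) ?_
    rw [Real.sq_sqrt (integral_nonneg fun _ => sq_nonneg _)]
  have hmeanlim := tendsto_lagged_average hA hwin h hg
  have htot := (((hlim 1 (by simp)).add (hlim (-1) (by simp))).div_const 4).add
    ((hmeanlim.sub_const g).abs)
  simp only [sub_self, abs_zero, add_zero, zero_div] at htot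
  refine squeeze_zero (fun _ => integral_nonneg fun _ => abs_nonneg _) (fun J => ?_) htot
  set E := (∑ t ∈ A J with t + (h : ℤ) ∈ A J, ∫ ω, Z J (t + h) ω * Z J t ω ∂P) / ((A J).card : ℝ)
  have l2 : ∀ r ∈ A J, MemLp (Z J r) 2 P := fun r hr =>
    ((hG J).hasGaussianLaw_eval ⟨r, hr⟩).memLp_two
  have hid : ∀ ω, (∑ t ∈ A J with t + (h : ℤ) ∈ A J, Z J (t + h) ω * Z J t ω) / (A J).card - g
      = (avg 1 J ω - avg (-1) J ω) / 4 + (E - g) := by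
    intro ω
    have : ∀ t ∈ (A J).filter fun t => t + (h : ℤ) ∈ A J, Z J (t + h) ω * Z J t ω
        = (V 1 J t ω - V (-1) J t ω) / 4 + ∫ ω, Z J (t + h) ω * Z J t ω ∂P := by
      intro t ht
      obtain ⟨ht0, hth⟩ := Finset.mem_filter.1 ht
      have k1 := ((l2 _ hth).add ((l2 _ ht0).const_mul 1)).integrable_sq
      have k2 := ((l2 _ hth).add ((l2 _ ht0).const_mul (-1))).integrable_sq
      have : ∫ ω, Z J (t + h) ω * Z J t ω ∂P
          = (∫ ω, (Z J (t + h) ω + 1 * Z J t ω) ^ 2 ∂P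
            - ∫ ω, (Z J (t + h) ω + (-1) * Z J t ω) ^ 2 ∂P) / 4 := by
        rw [eq_div_iff (by norm_num), ← integral_mul_const]
        refine Eq.trans ?_ (integral_sub k1 k2)
        refine integral_congr_ae (Eventually.of_forall fun ω => ?_)
        simp
        ring
      rw [this]
      simp only [hV]
      ring
    rw [Finset.sum_congr rfl this, Finset.sum_add_distrib, add_div, ← Finset.sum_div,
      Finset.sum_sub_distrib]
    simp only [havg, E]
    ring
  have ia := fun e => ((havgm e J).integrable (by norm_num)).abs
  calc ∫ ω, |(∑ t ∈ A J with t + (h : ℤ) ∈ A J, Z J (t + h) ω * Z J t ω) / (A J).card - g| ∂P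
      ≤ ∫ ω, ((|avg 1 J ω| + |avg (-1) J ω|) / 4 + |E - g|) ∂P := by
        refine integral_mono_of_nonneg (Eventually.of_forall fun _ => abs_nonneg _)
          ((((ia 1).add (ia (-1))).div_const 4).add (integrable_const _))
          (Eventually.of_forall fun ω => ?_)
        simp only [hid]
        refine (abs_add_le _ _).trans (add_le_add ?_ le_rfl)
        rw [abs_div, abs_of_pos (by norm_num : (0 : ℝ) < 4)]
        exact div_le_div_of_nonneg_right (abs_sub _ _) (by norm_num)
    _ = (∫ ω, |avg 1 J ω| ∂P + ∫ ω, |avg (-1) J ω| ∂P) / 4 + |E - g| := by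
        refine (integral_add (((ia 1).add (ia (-1))).div_const 4) (integrable_const _)).trans ?_
        rw [integral_div]
        refine congrArg₂ (· + ·) (congrArg (· / 4) (integral_add (ia 1) (ia (-1)))) (by simp)

end

/-! ### Truncated increments and independence at long distances. -/

noncomputable section

/-- Truncation at level `b`. -/
def clip (b : ℝ) : ℝ → ℝ := (Set.Icc (-b) b).indicator id

theorem measurable_clip (b : ℝ) : Measurable (clip b) :=
  measurable_id.indicator measurableSet_Icc

theorem abs_clip_le {b : ℝ} (hb : 0 ≤ b) (x : ℝ) : |clip b x| ≤ b := by
  unfold clip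
  by_cases hx : x ∈ Set.Icc (-b) b
  · rw [Set.indicator_of_mem hx]
    exact abs_le.2 hx
  · rw [Set.indicator_of_notMem hx]
    simpa using hb

theorem abs_sub_clip_le (b x : ℝ) : |x - clip b x| ≤ |x| := by
  unfold clip
  by_cases hx : x ∈ Set.Icc (-b) b
  · rw [Set.indicator_of_mem hx]
    simp
  · rw [Set.indicator_of_notMem hx]
    simp

variable {Ω : Type*} {ξ : ℕ → ℤ → Ω → ℝ} {a : ℕ → ℝ} {M : ℕ}

theorem nondecimatedHaar_abs_le_one (j : ℕ) (k t : ℤ) : |nondecimatedHaar j k t| ≤ 1 := by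
  unfold nondecimatedHaar
  by_cases h : k - t ∈ Finset.Ico (0 : ℤ) (2 ^ j)
  · rw [← sq_le_one_iff_abs_le_one, haarWavelet_sq h]
    exact inv_le_one_of_one_le₀ (one_le_pow₀ (by norm_num))
  · rw [haarWavelet_eq_zero h]
    simp

theorem card_Ico_scale (M : ℕ) (t : ℤ) : (Finset.Ico t (t + 2 ^ M)).card = 2 ^ M := by
  rw [Int.card_Ico, add_sub_cancel_left]
  exact Int.toNat_natCast (2 ^ M) ▸ by push_cast; rfl

theorem abs_haarSum_le {b : ℝ} (hb : ∀ j k ω, |ξ j k ω| ≤ b) (t : ℤ) (ω : Ω) :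
    |haarSum a ξ M t ω| ≤ (∑ j ∈ Finset.Icc 1 M, |a j|) * 2 ^ M * b := by
  have hb0 : 0 ≤ b := (abs_nonneg _).trans (hb 0 0 ω)
  rw [haarSum]
  refine (Finset.abs_sum_le_sum_abs _ _).trans ?_
  have : ∀ p ∈ Finset.Icc 1 M ×ˢ Finset.Ico t (t + 2 ^ M),
      |a p.1 * nondecimatedHaar p.1 p.2 t * ξ p.1 p.2 ω| ≤ |a p.1| * b := by
    intro p _
    rw [abs_mul, abs_mul]
    exact mul_le_mul (mul_le_of_le_one_right (abs_nonneg _) (nondecimatedHaar_abs_le_one _ _ _))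
      (hb _ _ _) (abs_nonneg _) (abs_nonneg _)
  refine (Finset.sum_le_sum this).trans (le_of_eq ?_)
  rw [Finset.sum_product]
  simp only [Finset.sum_const, card_Ico_scale, nsmul_eq_mul]
  rw [Finset.sum_mul, Finset.sum_mul]
  push_cast
  exact Finset.sum_congr rfl fun j _ => by ring

/-- The scales and locations that enter finite Haar sums at the times from `t` to `t + h`. -/
def scaleBlock (M h : ℕ) (t : ℤ) : Finset ({j : ℕ // 1 ≤ j} × ℤ) :=
  (Finset.Icc 1 M).subtype (1 ≤ ·) ×ˢ Finset.Ico t (t + h + 2 ^ M)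

theorem haarSum_eq_sum_scaleBlock {h : ℕ} {t s : ℤ} (hs : t ≤ s) (hst : s ≤ t + h) (ω : Ω) :
    haarSum a ξ M s ω = ∑ p : scaleBlock M h t,
      a p.1.1 * nondecimatedHaar p.1.1 p.1.2 s * ξ p.1.1 p.1.2 ω := by
  rw [haarSum_eq (B := Finset.Ico t (t + h + 2 ^ M))
    (Finset.Ico_subset_Ico hs (by omega)), Finset.sum_product,
    Finset.sum_coe_sort (scaleBlock M h t) fun p : {j : ℕ // 1 ≤ j} × ℤ =>
      a p.1 * nondecimatedHaar p.1 p.2 s * ξ p.1 p.2 ω, scaleBlock, Finset.sum_product,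
    Finset.sum_subtype_of_mem (p := (1 ≤ ·)) fun j =>
      ∑ k ∈ Finset.Ico t (t + h + 2 ^ M), a j * nondecimatedHaar j k s * ξ j k ω]
  exact fun j hj => (Finset.mem_Icc.1 hj).1

variable [MeasurableSpace Ω] {P : Measure Ω}

/-- Dominated convergence: the integrand is at most f² and vanishes at each point once n ≥ |f|. -/
theorem tendsto_integral_sub_clip_sq {f : Ω → ℝ} (hf : MemLp f 2 P) :
    Tendsto (fun n : ℕ => ∫ ω, (f ω - clip n (f ω)) ^ 2 ∂P) atTop (𝓝 0) := by
  have hm := hf.aestronglyMeasurable.aemeasurable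
  have := tendsto_integral_of_dominated_convergence (μ := P) (f := fun _ => (0 : ℝ))
    (F := fun (n : ℕ) ω => (f ω - clip n (f ω)) ^ 2) (fun ω => f ω ^ 2)
    (fun n => ((hm.sub ((measurable_clip n).comp_aemeasurable hm)).pow_const 2).aestronglyMeasurable)
    hf.integrable_sq (fun n => Eventually.of_forall fun ω => by
      rw [Real.norm_eq_abs, abs_pow, ← sq_abs (f ω)]
      exact pow_le_pow_left₀ (abs_nonneg _) (abs_sub_clip_le _ _) 2)
    (Eventually.of_forall fun ω => by
      refine tendsto_const_nhds.congr' ?_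
      obtain ⟨N, hN⟩ := exists_nat_ge |f ω|
      filter_upwards [eventually_ge_atTop N] with n hn
      have : f ω ∈ Set.Icc (-(n : ℝ)) n := abs_le.1 (hN.trans (by exact_mod_cast hn))
      rw [clip, Set.indicator_of_mem this]
      simp)
  simpa using this

/-- Finite Haar sums depend continuously in mean square on their increments. -/
theorem integral_haarSum_sub_sq_le (ha : Summable fun j => a j ^ 2) {ξ' : ℕ → ℤ → Ω → ℝ} {r : ℝ}
    (hm : ∀ j, 1 ≤ j → ∀ k, MemLp (fun ω => ξ j k ω - ξ' j k ω) 2 P)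
    (hr : ∀ j, 1 ≤ j → ∀ k, ∫ ω, (ξ j k ω - ξ' j k ω) ^ 2 ∂P ≤ r) (t : ℤ) :
    ∫ ω, (haarSum a ξ M t ω - haarSum a ξ' M t ω) ^ 2 ∂P
      ≤ (M * 2 ^ M : ℕ) * (scaleTail a 0 * r) := by
  set S := Finset.Icc 1 M ×ˢ Finset.Ico t (t + 2 ^ M) with hS
  have hS1 : ∀ p ∈ S, 1 ≤ p.1 := one_le_of_mem_product
  have hcard : S.card = M * 2 ^ M := by
    rw [hS, Finset.card_product, card_Ico_scale, Nat.card_Icc, Nat.add_sub_cancel]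
  set c : ℕ × ℤ → ℝ := fun p => a p.1 * nondecimatedHaar p.1 p.2 t with hc
  have hc2 : ∑ p ∈ S, c p ^ 2 ≤ scaleTail a 0 := by
    rw [hS, Finset.sum_product, scaleTail_zero_eq ha M]
    have : ∀ j ∈ Finset.Icc 1 M, ∑ k ∈ Finset.Ico t (t + 2 ^ M), c (j, k) ^ 2 = a j ^ 2 := by
      intro j hj
      simp only [hc, mul_pow]
      rw [← Finset.mul_sum,
        sum_nondecimatedHaar_sq j t (Ico_scale_subset (Finset.mem_Icc.1 hj).2 t), mul_one]
    rw [Finset.sum_congr rfl this]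
    linarith [scaleTail_nonneg a M]
  have hi : ∀ p ∈ S, Integrable (fun ω => c p ^ 2 * (ξ p.1 p.2 ω - ξ' p.1 p.2 ω) ^ 2) P :=
    fun p hp => (hm p.1 (hS1 p hp) p.2).integrable_sq.const_mul _
  by_cases hne : S.Nonempty
  · obtain ⟨p₀, hp₀⟩ := hne
    have hr0 : 0 ≤ r := (integral_nonneg fun _ => sq_nonneg _).trans (hr p₀.1 (hS1 p₀ hp₀) p₀.2)
    calc ∫ ω, (haarSum a ξ M t ω - haarSum a ξ' M t ω) ^ 2 ∂P
        ≤ ∫ ω, (S.card : ℝ) * ∑ p ∈ S, c p ^ 2 * (ξ p.1 p.2 ω - ξ' p.1 p.2 ω) ^ 2 ∂P := by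
          refine integral_mono_of_nonneg (Eventually.of_forall fun _ => sq_nonneg _)
            ((integrable_finsetSum _ hi).const_mul _) (Eventually.of_forall fun ω => ?_)
          -- Truncated increments are no longer orthonormal in general, so Cauchy–Schwarz is used at
          -- the cost of a factor M·2^M, the number of terms.
          have := sq_sum_le_card_mul_sum_sq (s := S)
            (f := fun p => c p * (ξ p.1 p.2 ω - ξ' p.1 p.2 ω))
          simp only [haarSum, ← Finset.sum_sub_distrib, ← mul_sub]
          simpa only [mul_pow] using this
      _ = S.card * ∑ p ∈ S, c p ^ 2 * ∫ ω, (ξ p.1 p.2 ω - ξ' p.1 p.2 ω) ^ 2 ∂P := by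
          rw [integral_const_mul, integral_finsetSum _ hi]
          simp only [integral_const_mul]
      _ ≤ S.card * ∑ p ∈ S, c p ^ 2 * r := by
          gcongr with p hp
          exact hr p.1 (hS1 p hp) p.2
      _ ≤ (M * 2 ^ M : ℕ) * (scaleTail a 0 * r) := by
          rw [hcard, ← Finset.sum_mul]
          gcongr
  · have h0 : S = ∅ := Finset.not_nonempty_iff_eq_empty.1 hne
    have h1 : M * 2 ^ M = 0 := by rw [← hcard, h0, Finset.card_empty]
    have h2 : ∀ ζ : ℕ → ℤ → Ω → ℝ, ∀ ω, haarSum a ζ M t ω = 0 := fun ζ ω => by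
      rw [haarSum, ← hS, h0, Finset.sum_empty]
    simp [h1, h2]

/-- The product at `t` depends only on increments with locations in [t, t + h + 2^M), and the blocks
of `t` and `s` are disjoint. The function `φ` will be a truncation. -/
theorem indepFun_haarSum_mul {φ : ℝ → ℝ} (hφ : Measurable φ)
    (hindep : iIndepFun (fun p : {j : ℕ // 1 ≤ j} × ℤ => ξ p.1 p.2) P)
    (hm : ∀ j, 1 ≤ j → ∀ k, AEMeasurable (ξ j k) P) (h : ℕ) {t s : ℤ}
    (hts : ((2 ^ M + h : ℕ) : ℤ) < |t - s|) :
    IndepFun (fun ω => haarSum a (fun j k ω => φ (ξ j k ω)) M (t + h) ω *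
        haarSum a (fun j k ω => φ (ξ j k ω)) M t ω)
      (fun ω => haarSum a (fun j k ω => φ (ξ j k ω)) M (s + h) ω *
        haarSum a (fun j k ω => φ (ξ j k ω)) M s ω) P := by
  have hdisj : Disjoint (scaleBlock M h t) (scaleBlock M h s) := by
    rw [Finset.disjoint_left]
    intro p hp hp'
    have h1 := Finset.mem_Ico.1 (Finset.mem_product.1 hp).2
    have h2 := Finset.mem_Ico.1 (Finset.mem_product.1 hp').2
    push_cast at hts
    rcases abs_cases (t - s) with h3 | h3 <;> omega
  set F : (r : ℤ) → (scaleBlock M h r → ℝ) → ℝ := fun r x =>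
    (∑ p : scaleBlock M h r, a p.1.1 * nondecimatedHaar p.1.1 p.1.2 (r + h) * φ (x p)) *
      ∑ p : scaleBlock M h r, a p.1.1 * nondecimatedHaar p.1.1 p.1.2 r * φ (x p)
  have hF : ∀ r, Measurable (F r) := fun r => by
    refine Measurable.mul ?_ ?_ <;>
    exact Finset.measurable_sum _ fun p _ => (hφ.comp (measurable_pi_apply p)).const_mul _
  have := (hindep.indepFun_finset₀ _ _ hdisj fun p => hm p.1 p.1.2 p.2).comp (hF t) (hF s)
  convert this using 1
  · funext ω
    rw [haarSum_eq_sum_scaleBlock (h := h) (t := t) (s := t + h) (by omega) le_rfl,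
      haarSum_eq_sum_scaleBlock (h := h) (t := t) (s := t) le_rfl (by omega)]
    rfl
  · funext ω
    rw [haarSum_eq_sum_scaleBlock (h := h) (t := s) (s := s + h) (by omega) le_rfl,
      haarSum_eq_sum_scaleBlock (h := h) (t := s) (s := s) le_rfl (by omega)]
    rfl

end

/-! ### The law of large numbers for Y. -/

noncomputable section

variable {Ω : Type*} [MeasurableSpace Ω] {P : Measure Ω}

theorem integral_add_sq_le {f g : Ω → ℝ} (hf : MemLp f 2 P) (hg : MemLp g 2 P) :
    ∫ ω, (f ω + g ω) ^ 2 ∂P ≤ 2 * ∫ ω, f ω ^ 2 ∂P + 2 * ∫ ω, g ω ^ 2 ∂P := by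
  rw [← integral_const_mul, ← integral_const_mul,
    ← integral_add (hf.integrable_sq.const_mul 2) (hg.integrable_sq.const_mul 2)]
  refine integral_mono (hf.add hg).integrable_sq
    ((hf.integrable_sq.const_mul 2).add (hg.integrable_sq.const_mul 2)) fun ω => ?_
  simp only
  nlinarith [sq_nonneg (f ω - g ω)]

variable [IsProbabilityMeasure P]
  {ξ : ℕ → ℤ → Ω → ℝ} {a : ℕ → ℝ} {A : ℕ → Finset ℤ} {Z : ℕ → ℤ → Ω → ℝ}

/-- Finite Haar sums of bounded increments approximate in mean square, uniformly on windows. -/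
theorem IsHaarApprox.exists_clip (hξ : IsOrthonormalArray P ξ) (ha : Summable fun j => a j ^ 2)
    (hident : ∀ j, 1 ≤ j → ∀ k, ∀ l, 1 ≤ l → ∀ m, IdentDistrib (ξ j k) (ξ l m) P P)
    (hZ : IsHaarApprox P a ξ A Z) {ε : ℝ} (hε : 0 < ε) :
    ∃ M n : ℕ, ∀ᶠ J in atTop, ∀ t ∈ A J,
      ∫ ω, (Z J t ω - haarSum a (fun j k ω => clip n (ξ j k ω)) M t ω) ^ 2 ∂P ≤ ε := by
  obtain ⟨M, hM⟩ := (hZ.approx (ε / 4) (by positivity)).exists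
  -- The truncation level is chosen after `M`, to beat the factor M·2^M. One level serves all
  -- increments because they are identically distributed.
  have hlim : Tendsto (fun n : ℕ => ((M * 2 ^ M : ℕ) : ℝ) * (scaleTail a 0 *
      ∫ ω, (ξ 1 0 ω - clip n (ξ 1 0 ω)) ^ 2 ∂P)) atTop (𝓝 0) := by
    simpa using ((tendsto_integral_sub_clip_sq (hξ.memLp 1 le_rfl 0)).const_mul
      (scaleTail a 0)).const_mul ((M * 2 ^ M : ℕ) : ℝ)
  obtain ⟨n, hn⟩ := (hlim.eventually_le_const (show 0 < ε / 4 by positivity)).exists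
  have hclip : ∀ j, 1 ≤ j → ∀ k, MemLp (fun ω => clip n (ξ j k ω)) 2 P := fun j hj k =>
    MemLp.of_bound ((measurable_clip n).comp_aemeasurable
      (hξ.memLp j hj k).aestronglyMeasurable.aemeasurable).aestronglyMeasurable n
      (Eventually.of_forall fun ω => abs_clip_le (Nat.cast_nonneg n) _)
  have hdiff : ∀ t, ∫ ω, (haarSum a ξ M t ω
      - haarSum a (fun j k ω => clip n (ξ j k ω)) M t ω) ^ 2 ∂P ≤ ε / 4 := by
    intro t
    refine (integral_haarSum_sub_sq_le ha (fun j hj k => (hξ.memLp j hj k).sub (hclip j hj k))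
      (fun j hj k => le_of_eq ?_) t).trans hn
    exact ((hident j hj k 1 le_rfl 0).comp
      ((measurable_id.sub (measurable_clip n)).pow_const 2)).integral_eq
  refine ⟨M, n, hM.mono fun J hJ t ht => ?_⟩
  have m1 : MemLp (fun ω => Z J t ω - haarSum a ξ M t ω) 2 P :=
    (hZ.memLp J t ht).sub (memLp_haarSum hξ a M t)
  have m2 : MemLp (fun ω => haarSum a ξ M t ω
      - haarSum a (fun j k ω => clip n (ξ j k ω)) M t ω) 2 P :=
    (memLp_haarSum hξ a M t).sub (memLp_finsetSum _ fun p hp =>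
      (hclip p.1 (one_le_of_mem_product p hp) p.2).const_mul _)
  have := integral_add_sq_le m1 m2
  simp only [sub_add_sub_cancel] at this
  linarith [hJ t ht, hdiff t]

/-- The law of large numbers for lagged products of an array that is approximated by Haar sums of
independent identically distributed increments. -/
theorem tendsto_integral_abs_lagged_products_indep
    (hA : Tendsto (fun J => ((A J).card : ℝ)) atTop atTop)
    (hwin : ∀ᶠ J in atTop, ∃ b c, A J = Finset.Icc b c)
    (hξ : IsOrthonormalArray P ξ) (ha : Summable fun j => a j ^ 2)
    (hindep : iIndepFun (fun p : {j : ℕ // 1 ≤ j} × ℤ => ξ p.1 p.2) P)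
    (hident : ∀ j, 1 ≤ j → ∀ k, ∀ l, 1 ≤ l → ∀ m, IdentDistrib (ξ j k) (ξ l m) P P)
    (hZ : IsHaarApprox P a ξ A Z) (h : ℕ) :
    Tendsto (fun J => ∫ ω, |(∑ t ∈ A J with t + (h : ℤ) ∈ A J,
      Z J (t + h) ω * Z J t ω) / (A J).card - haarAutocov a h| ∂P) atTop (𝓝 0) := by
  rw [Metric.tendsto_nhds]
  intro ε hε
  set c := √(scaleTail a 0 + 1) with hc
  have hc0 : 0 ≤ c := Real.sqrt_nonneg _
  have hc2 : c ^ 2 = scaleTail a 0 + 1 := Real.sq_sqrt (by linarith [scaleTail_nonneg a 0])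
  set η := min 1 (ε / 8 / (1 + 2 * c))
  have hη : 0 < η := lt_min one_pos (by positivity)
  have hη1 : η ≤ 1 := min_le_left _ _
  have hη2 : η * (1 + 2 * c) ≤ ε / 8 := by
    rw [← le_div_iff₀ (by positivity)]
    exact min_le_right _ _
  have hη3 : η * (η + 2 * c) ≤ ε / 8 :=
    (mul_le_mul_of_nonneg_left (by linarith) hη.le).trans hη2
  obtain ⟨M, n, hMn⟩ := hZ.exists_clip hξ ha hident (ε := η ^ 2) (by positivity)
  set H : ℤ → Ω → ℝ := haarSum a (fun j k ω => clip n (ξ j k ω)) M with hH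
  obtain ⟨b, hb0, hHb⟩ : ∃ b : ℝ, 0 ≤ b ∧ ∀ t ω, |H t ω| ≤ b :=
    ⟨(∑ j ∈ Finset.Icc 1 M, |a j|) * 2 ^ M * n, by positivity, fun t ω =>
      abs_haarSum_le (fun j k ω => abs_clip_le (Nat.cast_nonneg n) _) t ω⟩
  have hξm : ∀ j, 1 ≤ j → ∀ k, AEMeasurable (ξ j k) P := fun j hj k =>
    (hξ.memLp j hj k).aestronglyMeasurable.aemeasurable
  have hHm : ∀ t, AEStronglyMeasurable (H t) P := fun t =>
    (Finset.aemeasurable_fun_sum _ fun p hp => ((measurable_clip n).comp_aemeasurable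
      (hξm p.1 (one_le_of_mem_product p hp) p.2)).const_mul _).aestronglyMeasurable
  have hH2 : ∀ t, MemLp (H t) 2 P := fun t =>
    MemLp.of_bound (hHm t) b (Eventually.of_forall fun ω => hHb t ω)
  set V : ℕ → ℤ → Ω → ℝ := fun _ t ω => H (t + h) ω * H t ω - ∫ ω', H (t + h) ω' * H t ω' ∂P with hV
  have hprodb : ∀ t ω, |H (t + h) ω * H t ω| ≤ b * b := fun t ω => by
    rw [abs_mul]
    exact mul_le_mul (hHb _ _) (hHb _ _) (abs_nonneg _) hb0
  have hVb : ∀ J t ω, |V J t ω| ≤ 2 * (b * b) := by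
    intro J t ω
    have h1 : |∫ ω', H (t + h) ω' * H t ω' ∂P| ≤ b * b := by
      have := norm_integral_le_of_norm_le_const (μ := P)
        (f := fun ω => H (t + h) ω * H t ω) (Eventually.of_forall fun ω => hprodb t ω)
      simpa using this
    have h2 := hprodb t ω
    refine (abs_sub _ _).trans ?_
    linarith
  have hprodi : ∀ t, Integrable (fun ω => H (t + h) ω * H t ω) P := fun t =>
    (hH2 _).integrable_mul (hH2 _)
  have hVm : ∀ J t, MemLp (V J t) 2 P := fun J t =>
    MemLp.of_bound (((hHm _).mul (hHm _)).sub aestronglyMeasurable_const) (2 * (b * b))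
      (Eventually.of_forall fun ω => hVb J t ω)
  have hV0 : ∀ J t, ∫ ω, V J t ω ∂P = 0 := by
    intro J t
    simp only [hV]
    rw [integral_sub (hprodi t) (integrable_const _)]
    simp
  -- The centred truncated products are bounded, and independent beyond distance 2^M + h.
  have hcov : IsWeaklyCorrelated P (fun J => (A J).filter fun t => t + (h : ℤ) ∈ A J) V := by
    intro δ hδ
    refine ⟨2 ^ M + h, 2 * (b * b) * (2 * (b * b)), by positivity,
      Eventually.of_forall fun J t _ s _ => ?_⟩
    split_ifs with hts
    · have := norm_integral_le_of_norm_le_const (μ := P) (f := fun ω => V J t ω * V J s ω)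
        (C := 2 * (b * b) * (2 * (b * b))) (Eventually.of_forall fun ω => by
          rw [Real.norm_eq_abs, abs_mul]
          exact mul_le_mul (hVb J t ω) (hVb J s ω) (abs_nonneg _) (by positivity))
      simp only [Real.norm_eq_abs, probReal_univ, mul_one] at this
      linarith
    · have hind := (indepFun_haarSum_mul (a := a) (M := M) (measurable_clip n) hindep hξm h
        (not_le.1 hts)).comp
        (measurable_id.sub_const (∫ ω', H (t + h) ω' * H t ω' ∂P))
        (measurable_id.sub_const (∫ ω', H (s + h) ω' * H s ω' ∂P))
      have h1 : ∫ ω, V J t ω * V J s ω ∂P = (∫ ω, V J t ω ∂P) * ∫ ω, V J s ω ∂P :=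
        hind.integral_fun_mul_eq_mul_integral (hVm J t).aestronglyMeasurable
          (hVm J s).aestronglyMeasurable
      rw [h1, hV0 J t, zero_mul, abs_zero, add_zero]
      exact hδ.le
  set avg : ℕ → Ω → ℝ := fun J ω =>
    (∑ t ∈ A J with t + (h : ℤ) ∈ A J, V J t ω) / (A J).card with havg
  have havgm : ∀ J, MemLp (avg J) 2 P := by
    intro J
    simp only [havg, div_eq_mul_inv]
    exact (memLp_finsetSum _ fun t _ => hVm J t).mul_const _
  have havglim : Tendsto (fun J => ∫ ω, |avg J ω| ∂P) atTop (𝓝 0) := by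
    have h1 := (tendsto_integral_average_sq hA (fun J => Finset.filter_subset _ _)
      (fun J t _ => hVm J t) hcov).sqrt
    rw [Real.sqrt_zero] at h1
    refine squeeze_zero (fun _ => integral_nonneg fun _ => abs_nonneg _) (fun J => ?_) h1
    refine integral_abs_le_of_sq_le (havgm J) (Real.sqrt_nonneg _) ?_
    rw [Real.sq_sqrt (integral_nonneg fun _ => sq_nonneg _)]
  have hElim := tendsto_lagged_average hA hwin h (g := haarAutocov a h)
    (e := fun J t => ∫ ω, Z J (t + h) ω * Z J t ω ∂P) fun δ hδ => by
      filter_upwards [hZ.abs_cov_sub_le hξ ha hδ] with J hJ t ht hth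
      have := hJ _ hth _ ht
      rwa [sub_add_cancel_left, haarAutocov_neg] at this
  have hElim' := ((hElim.sub_const (haarAutocov a h)).abs)
  rw [sub_self, abs_zero] at hElim'
  filter_upwards [hMn, hZ.abs_cov_sub_le hξ ha one_pos, hA.eventually_gt_atTop 0,
    havglim.eventually_lt_const (show 0 < ε / 4 by positivity),
    hElim'.eventually_lt_const (show 0 < ε / 4 by positivity)] with J hJ hJ1 hpos hJ2 hJ3
  rw [Real.dist_0_eq_abs, abs_of_nonneg (integral_nonneg fun _ => abs_nonneg _)]
  -- The extra 1 in the definition of `c` absorbs the gap between the second moment of `Z` and its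
  -- limit.
  have hZc : ∀ t ∈ A J, ∫ ω, Z J t ω ^ 2 ∂P ≤ c ^ 2 := by
    intro t ht
    have h1 := (abs_le.1 (hJ1 t ht t ht)).2
    have h2 := (le_abs_self _).trans (abs_haarAutocov_le ha (t - t))
    rw [hc2]
    simp only [sq]
    linarith
  set D : ℤ → Ω → ℝ := fun t ω => Z J (t + h) ω * Z J t ω - H (t + h) ω * H t ω with hD
  have hDb : ∀ t ∈ (A J).filter fun t => t + (h : ℤ) ∈ A J, ∫ ω, |D t ω| ∂P ≤ ε / 8 := by
    intro t ht
    obtain ⟨ht0, hth⟩ := Finset.mem_filter.1 ht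
    exact (integral_abs_mul_sub_mul_le (hZ.memLp J _ hth) (hZ.memLp J t ht0) (hH2 _) (hH2 _)
      hη.le hc0 (hJ _ hth) (hJ _ ht0) (hZc _ hth) (hZc _ ht0)).trans hη3
  have hZi : ∀ t ∈ (A J).filter fun t => t + (h : ℤ) ∈ A J,
      Integrable (fun ω => Z J (t + h) ω * Z J t ω) P := fun t ht =>
    (hZ.memLp J _ (Finset.mem_filter.1 ht).2).integrable_mul
      (hZ.memLp J _ (Finset.mem_filter.1 ht).1)
  have hDi : ∀ t ∈ (A J).filter fun t => t + (h : ℤ) ∈ A J, Integrable (D t) P := fun t ht =>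
    (hZi t ht).sub (hprodi t)
  set n' : ℝ := ((A J).card : ℝ) with hn'
  set E := (∑ t ∈ A J with t + (h : ℤ) ∈ A J, ∫ ω, Z J (t + h) ω * Z J t ω ∂P) / n'
  set Q : Ω → ℝ := fun ω => (∑ t ∈ A J with t + (h : ℤ) ∈ A J, |D t ω|) / n' with hQ
  have hQi : Integrable Q P := (integrable_finsetSum _ fun t ht => (hDi t ht).abs).div_const _
  have hQb : ∫ ω, Q ω ∂P ≤ ε / 8 := by
    simp only [hQ]
    rw [integral_div, integral_finsetSum _ fun t ht => (hDi t ht).abs, div_le_iff₀ hpos]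
    refine (Finset.sum_le_sum hDb).trans ?_
    rw [Finset.sum_const, nsmul_eq_mul, mul_comm]
    exact mul_le_mul_of_nonneg_left (Nat.cast_le.2 (Finset.card_filter_le _ _)) (by positivity)
  set R := (∑ t ∈ A J with t + (h : ℤ) ∈ A J, ∫ ω, D t ω ∂P) / n' with hR
  have hRb : |R| ≤ ε / 8 := by
    refine le_trans ?_ hQb
    simp only [hQ]
    rw [integral_div, integral_finsetSum _ fun t ht => (hDi t ht).abs, hR, abs_div,
      abs_of_pos hpos]
    refine div_le_div_of_nonneg_right ((Finset.abs_sum_le_sum_abs _ _).trans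
      (Finset.sum_le_sum fun t _ => abs_integral_le_integral_abs)) hpos.le
  -- The mean of the truncated products is never computed: it is the mean E of the original products
  -- minus R, the mean truncation error. The four pieces cost ε/8, ε/4, ε/4 and ε/8, less than ε in
  -- all.
  have hid : ∀ ω, (∑ t ∈ A J with t + (h : ℤ) ∈ A J, Z J (t + h) ω * Z J t ω) / n'
      - haarAutocov a h = (∑ t ∈ A J with t + (h : ℤ) ∈ A J, D t ω) / n' + avg J ω
        + (E - haarAutocov a h - R) := by
    intro ω
    have : ∀ t ∈ (A J).filter fun t => t + (h : ℤ) ∈ A J, Z J (t + h) ω * Z J t ω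
        = D t ω + V J t ω + (∫ ω, Z J (t + h) ω * Z J t ω ∂P - ∫ ω, D t ω ∂P) := by
      intro t ht
      have : ∫ ω, D t ω ∂P = ∫ ω, Z J (t + h) ω * Z J t ω ∂P - ∫ ω, H (t + h) ω * H t ω ∂P :=
        integral_sub (hZi t ht) (hprodi t)
      rw [this]
      simp only [hD, hV]
      ring
    have hsum : ∑ t ∈ A J with t + (h : ℤ) ∈ A J, Z J (t + h) ω * Z J t ω
        = ∑ t ∈ A J with t + (h : ℤ) ∈ A J, D t ω + ∑ t ∈ A J with t + (h : ℤ) ∈ A J, V J t ω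
          + (∑ t ∈ A J with t + (h : ℤ) ∈ A J, ∫ ω, Z J (t + h) ω * Z J t ω ∂P
            - ∑ t ∈ A J with t + (h : ℤ) ∈ A J, ∫ ω, D t ω ∂P) := by
      rw [← Finset.sum_add_distrib, ← Finset.sum_sub_distrib, ← Finset.sum_add_distrib]
      exact Finset.sum_congr rfl this
    simp only [havg, E, hR, hsum, ← hn', add_div, sub_div]
    ring
  have ia := ((havgm J).integrable (by norm_num)).abs
  have hle : ∫ ω, |(∑ t ∈ A J with t + (h : ℤ) ∈ A J, Z J (t + h) ω * Z J t ω) / n'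
      - haarAutocov a h| ∂P
      ≤ ∫ ω, Q ω ∂P + ∫ ω, |avg J ω| ∂P + (|E - haarAutocov a h| + |R|) := by
    refine (integral_mono_of_nonneg (g := fun ω => Q ω + |avg J ω|
      + (|E - haarAutocov a h| + |R|)) (Eventually.of_forall fun _ => abs_nonneg _)
      ((hQi.add ia).add (integrable_const _)) (Eventually.of_forall fun ω => ?_)).trans
      (le_of_eq ?_)
    · simp only [hid]
      refine (abs_add_le _ _).trans (add_le_add ((abs_add_le _ _).trans
        (add_le_add ?_ le_rfl)) (abs_sub _ _))
      simp only [hQ]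
      rw [abs_div, abs_of_pos hpos]
      exact div_le_div_of_nonneg_right (Finset.abs_sum_le_sum_abs _ _) hpos.le
    · refine (integral_add (hQi.add ia) (integrable_const _)).trans ?_
      exact congrArg₂ (· + ·) (integral_add hQi ia) (by simp)
  linarith

end

/-! ### The windows, and mean square approximation of X and Y. -/

noncomputable section

theorem mem_windowTimes {z l : ℝ} {T : ℕ} {t : ℤ} (h : t ∈ windowTimes z l T) :
    0 ≤ t ∧ t < T ∧ |(t : ℝ) / T - z| ≤ l / (2 * T) := by
  rw [windowTimes, Finset.mem_filter, Finset.mem_Ico, Set.mem_Icc] at h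
  refine ⟨h.1.1, h.1.2, ?_⟩
  rw [abs_le]
  constructor <;> linarith [h.2.1, h.2.2]

/-- Once l/T is below z and 1 - z, the restriction 0 ≤ t < T holds by itself. -/
theorem windowTimes_eq_Icc {z l : ℝ} {T : ℕ} (hT : 0 < T) (h0 : l / T < z) (h1 : l / T < 1 - z)
    (hl : 0 ≤ l) :
    windowTimes z l T = Finset.Icc ⌈z * T - l / 2⌉ ⌊z * T + l / 2⌋ := by
  have hT' : (0 : ℝ) < T := by exact_mod_cast hT
  rw [div_lt_iff₀ hT'] at h0 h1
  ext t
  rw [windowTimes, Finset.mem_filter, Finset.mem_Ico, Set.mem_Icc, Finset.mem_Icc, Int.ceil_le,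
    Int.le_floor]
  have e1 : z - l / (2 * T) = (z * T - l / 2) / T := by field_simp
  have e2 : z + l / (2 * T) = (z * T + l / 2) / T := by field_simp
  rw [e1, e2, div_le_div_iff_of_pos_right hT', div_le_div_iff_of_pos_right hT']
  refine ⟨fun h => h.2, fun h => ⟨⟨?_, ?_⟩, h⟩⟩
  · have : (0 : ℝ) ≤ t := by linarith [h.1]
    exact_mod_cast this
  · have : (t : ℝ) < (T : ℝ) := by linarith [h.2]
    exact_mod_cast this

variable {L : ℕ → ℝ} {z : ℝ}

theorem tendsto_two_pow_atTop : Tendsto (fun J : ℕ => 2 ^ J) atTop (atTop : Filter ℕ) :=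
  tendsto_pow_atTop_atTop_of_one_lt one_lt_two

theorem eventually_windowTimes_eq_Icc (hL : Tendsto L atTop atTop)
    (hLT : Tendsto (fun T : ℕ => L T / T) atTop (𝓝 0)) (hz : z ∈ Set.Ioo (0 : ℝ) 1) :
    ∀ᶠ T : ℕ in atTop, windowTimes z (L T) T = Finset.Icc ⌈z * T - L T / 2⌉ ⌊z * T + L T / 2⌋ := by
  filter_upwards [eventually_gt_atTop 0, hLT.eventually_lt_const hz.1,
    hLT.eventually_lt_const (show 0 < 1 - z by linarith [hz.2]), hL.eventually_ge_atTop 0]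
    with T h1 h2 h3 h4
  exact windowTimes_eq_Icc h1 h2 h3 h4

theorem tendsto_card_windowTimes (hL : Tendsto L atTop atTop)
    (hLT : Tendsto (fun T : ℕ => L T / T) atTop (𝓝 0)) (hz : z ∈ Set.Ioo (0 : ℝ) 1) :
    Tendsto (fun T : ℕ => ((windowTimes z (L T) T).card : ℝ)) atTop atTop := by
  refine tendsto_atTop_mono' _ ?_ (tendsto_atTop_add_const_right _ (-1) hL)
  filter_upwards [eventually_windowTimes_eq_Icc hL hLT hz] with T hT
  rw [hT, Int.card_Icc]
  have h1 := Int.ceil_lt_add_one (z * T - L T / 2)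
  have h2 := Int.sub_one_lt_floor (z * T + L T / 2)
  have h3 : ((⌊z * T + L T / 2⌋ + 1 - ⌈z * T - L T / 2⌉ : ℤ) : ℝ)
      ≤ ((⌊z * T + L T / 2⌋ + 1 - ⌈z * T - L T / 2⌉).toNat : ℝ) := by
    exact_mod_cast Int.self_le_toNat _
  push_cast at h3
  linarith

variable {Ω : Type*} {a : ℕ → ℝ} {ξ : ℕ → ℤ → Ω → ℝ} {M J : ℕ}

/-- Padding with zero amplitudes above `M` allows subtraction term by term from a sum over `J`
scales. -/
theorem haarSum_eq_of_le (h : M ≤ J) (t : ℤ) (ω : Ω) : haarSum a ξ M t ω =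
    ∑ p ∈ Finset.Icc 1 J ×ˢ Finset.Ico t (t + 2 ^ J),
      (if p.1 ≤ M then a p.1 else 0) * nondecimatedHaar p.1 p.2 t * ξ p.1 p.2 ω := by
  rw [haarSum_eq (Ico_scale_subset h t)]
  simp only [ite_mul, zero_mul]
  rw [← Finset.sum_filter]
  refine Finset.sum_congr ?_ fun _ _ => rfl
  ext p
  simp only [Finset.mem_product, Finset.mem_filter, Finset.mem_Icc]
  constructor
  · rintro ⟨⟨h1, h2⟩, h3⟩
    exact ⟨⟨⟨h1, h2.trans h⟩, h3⟩, h2⟩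
  · rintro ⟨⟨⟨h1, _⟩, h3⟩, h2⟩
    exact ⟨⟨h1, h2⟩, h3⟩

variable [MeasurableSpace Ω] {P : Measure Ω}

/-- Orthonormality turns the integral into a sum of squares, and at each scale the squared wavelet
has total mass 1. Amplitudes matter on the support of the wavelet only. -/
theorem integral_scale_sum_sq_le (hξ : IsOrthonormalArray P ξ) {t : ℤ} {e : ℕ → ℤ → ℝ} {E : ℕ → ℝ}
    (he : ∀ j, 1 ≤ j → j ≤ J → ∀ k ∈ Finset.Ico t (t + 2 ^ j), e j k ^ 2 ≤ E j) :
    ∫ ω, (∑ p ∈ Finset.Icc 1 J ×ˢ Finset.Ico t (t + 2 ^ J),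
      e p.1 p.2 * nondecimatedHaar p.1 p.2 t * ξ p.1 p.2 ω) ^ 2 ∂P ≤ ∑ j ∈ Finset.Icc 1 J, E j := by
  rw [hξ.integral_sum_sq one_le_of_mem_product fun p => e p.1 p.2 * nondecimatedHaar p.1 p.2 t,
    Finset.sum_product]
  refine Finset.sum_le_sum fun j hj => ?_
  have hj' := Finset.mem_Icc.1 hj
  calc ∑ k ∈ Finset.Ico t (t + 2 ^ J), (e j k * nondecimatedHaar j k t) ^ 2
      ≤ ∑ k ∈ Finset.Ico t (t + 2 ^ J), E j * nondecimatedHaar j k t ^ 2 := by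
        refine Finset.sum_le_sum fun k _ => ?_
        rw [mul_pow]
        by_cases hk : k ∈ Finset.Ico t (t + 2 ^ j)
        · exact mul_le_mul_of_nonneg_right (he j hj'.1 hj'.2 k hk) (sq_nonneg _)
        · simp [nondecimatedHaar_eq_zero hk]
    _ = E j := by
        rw [← Finset.mul_sum, sum_nondecimatedHaar_sq j t (Ico_scale_subset hj'.2 t), mul_one]

theorem tendsto_integral_sq_of_tendsto_eLpNorm {f : ℕ → Ω → ℝ} (hf : ∀ n, MemLp (f n) 2 P)
    (h : Tendsto (fun n => eLpNorm (f n) 2 P) atTop (𝓝 0)) :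
    Tendsto (fun n => ∫ ω, f n ω ^ 2 ∂P) atTop (𝓝 0) := by
  have h1 := ((ENNReal.tendsto_toReal ENNReal.zero_ne_top).comp h).pow 2
  simp only [ENNReal.toReal_zero, ne_eq, OfNat.ofNat_ne_zero, not_false_eq_true, zero_pow] at h1
  refine h1.congr fun n => ?_
  have hn : 0 ≤ ∫ ω, f n ω ^ 2 ∂P := integral_nonneg fun _ => sq_nonneg _
  rw [Function.comp_apply, (hf n).eLpNorm_eq_integral_rpow_norm (by norm_num) (by norm_num)]
  simp only [ENNReal.toReal_ofNat, Real.rpow_ofNat, Real.norm_eq_abs, sq_abs]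
  rw [ENNReal.toReal_ofReal (by positivity), ← Real.rpow_natCast, ← Real.rpow_mul hn]
  norm_num

theorem IsStationaryHaar.isOrthonormalArray {Y : ℤ → Ω → ℝ}
    (hY : IsStationaryHaar P a ξ Y) : IsOrthonormalArray P ξ where
  memLp := hY.memLp_increment
  mean := hY.mean_increment
  inner j hj k l hl m := by
    by_cases h : j = l ∧ k = m
    · obtain ⟨rfl, rfl⟩ := h
      rw [if_pos ⟨rfl, rfl⟩, ← hY.variance_increment j hj k, variance_of_integral_eq_zero
        (hY.memLp_increment j hj k).aestronglyMeasurable.aemeasurable (hY.mean_increment j hj k)]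
      simp only [sq]
    · rw [if_neg h]
      have hne : ((⟨j, hj⟩, k) : {j : ℕ // 1 ≤ j} × ℤ) ≠ (⟨l, hl⟩, m) := by
        intro h'
        simp only [Prod.mk.injEq, Subtype.mk.injEq] at h'
        exact h h'
      have hi : ∫ ω, ξ j k ω * ξ l m ω ∂P = (∫ ω, ξ j k ω ∂P) * ∫ ω, ξ l m ω ∂P :=
        (hY.indep.indepFun hne).integral_fun_mul_eq_mul_integral
          (hY.memLp_increment j hj k).aestronglyMeasurable
          (hY.memLp_increment l hl m).aestronglyMeasurable
      rw [hi, hY.mean_increment j hj k, zero_mul]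

/-- Insert the sum over n scales and let n tend to infinity: the first difference vanishes in the
limit, and the second has variance at most `scaleTail a M`. The factor 2 comes from the square of a
sum. -/
theorem IsStationaryHaar.integral_sub_haarSum_sq_le {Y : ℤ → Ω → ℝ}
    (hY : IsStationaryHaar P a ξ Y) (ha : Summable fun j => a j ^ 2) (M : ℕ) (t : ℤ) :
    ∫ ω, (Y t ω - haarSum a ξ M t ω) ^ 2 ∂P ≤ 2 * scaleTail a M := by
  have hξ := hY.isOrthonormalArray
  have hlim := hY.representation t
  simp only [← haarSum_eq_tsum] at hlim
  have hm : ∀ n, MemLp (fun ω => Y t ω - haarSum a ξ n t ω) 2 P := fun n =>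
    (hY.memLp t).sub (memLp_haarSum hξ a n t)
  have hlim2 := ((tendsto_integral_sq_of_tendsto_eLpNorm hm hlim).const_mul 2).add_const
    (2 * scaleTail a M)
  rw [mul_zero, zero_add] at hlim2
  refine ge_of_tendsto hlim2 ?_
  filter_upwards [eventually_ge_atTop M] with n hn
  have hd : MemLp (fun ω => haarSum a ξ n t ω - haarSum a ξ M t ω) 2 P :=
    (memLp_haarSum hξ a n t).sub (memLp_haarSum hξ a M t)
  have h1 := integral_add_sq_le (hm n) hd
  simp only [sub_add_sub_cancel] at h1
  have h2 : ∫ ω, (haarSum a ξ n t ω - haarSum a ξ M t ω) ^ 2 ∂P ≤ scaleTail a M := by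
    have : ∀ ω, haarSum a ξ n t ω - haarSum a ξ M t ω
        = ∑ p ∈ Finset.Icc 1 n ×ˢ Finset.Ico t (t + 2 ^ n),
          (if M < p.1 then a p.1 else 0) * nondecimatedHaar p.1 p.2 t * ξ p.1 p.2 ω := by
      intro ω
      rw [haarSum, haarSum_eq_of_le hn, ← Finset.sum_sub_distrib]
      refine Finset.sum_congr rfl fun p _ => ?_
      rcases le_or_gt p.1 M with h | h
      · rw [if_pos h, if_neg (not_lt.2 h)]
        ring
      · rw [if_neg (not_le.2 h), if_pos h]
        ring
    simp only [this]
    refine (integral_scale_sum_sq_le hξ (e := fun j _ => if M < j then a j else 0)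
      (E := fun j => if M < j then a j ^ 2 else 0) fun j _ _ k _ => ?_).trans ?_
    · split_ifs <;> simp
    · rw [← Finset.sum_filter]
      exact sum_filter_lt_le_scaleTail ha hn
  linarith

theorem IsStationaryHaar.isHaarApprox {Y : ℤ → Ω → ℝ} (hY : IsStationaryHaar P a ξ Y)
    (ha : Summable fun j => a j ^ 2) (A : ℕ → Finset ℤ) :
    IsHaarApprox P a ξ A fun _ t => Y t where
  memLp _ t _ := hY.memLp t
  approx ε hε := by
    filter_upwards [(tendsto_scaleTail a).eventually_le_const (half_pos hε)] with M hM
    exact Eventually.of_forall fun J t _ =>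
      (hY.integral_sub_haarSum_sq_le ha M t).trans (by linarith)

variable {W : ℕ → ℝ → ℝ} {lip : ℕ → ℝ≥0} {C : ℕ → ℝ} {K : ℕ → Set ℤ} {w : ℕ → ℕ → ℤ → ℝ}
  {X : ℕ → ℤ → Ω → ℝ}

theorem IsHaarLSW.isOrthonormalArray (hX : IsHaarLSW P W lip C K w ξ X) :
    IsOrthonormalArray P ξ :=
  ⟨hX.memLp_increment, hX.mean_increment, hX.orthonormal_increment⟩

open Classical in
-- Amplitudes are extended by zero outside `K`, so that the index set no longer depends on `K`.
theorem IsHaarLSW.ae_eq_sum (hX : IsHaarLSW P W lip C K w ξ X) {t : ℤ} (h0 : 0 ≤ t)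
    (ht : t < 2 ^ J) : X (2 ^ J) t =ᵐ[P] fun ω =>
      ∑ p ∈ Finset.Icc 1 J ×ˢ Finset.Ico t (t + 2 ^ J),
        (if p.2 ∈ K (2 ^ J) then w (2 ^ J) p.1 p.2 else 0) * nondecimatedHaar p.1 p.2 t
          * ξ p.1 p.2 ω := by
  refine (hX.representation J t h0 ht).trans (Eventually.of_forall fun ω => ?_)
  dsimp only
  rw [Finset.sum_product]
  refine Finset.sum_congr rfl fun j hj => ?_
  rw [tsum_subtype (K (2 ^ J)) fun k => w (2 ^ J) j k * nondecimatedHaar j k t * ξ j k ω,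
    tsum_eq_sum (s := Finset.Ico t (t + 2 ^ J))]
  · refine Finset.sum_congr rfl fun k _ => ?_
    rw [Set.indicator_apply]
    split_ifs <;> simp
  · intro k hk
    have : nondecimatedHaar j k t = 0 := nondecimatedHaar_eq_zero fun h =>
      hk (Ico_scale_subset (Finset.mem_Icc.1 hj).2 t h)
    rw [Set.indicator_apply, this]
    simp

/-- A location in the support is within 2^j of `t`, and t/T is close to z, so |k/T - z| ≤ (2^j +
|l|)/T. The bound is a factor depending on T times one depending on the scale, the latter square
summable. -/
theorem IsHaarLSW.abs_amplitude_sub_le (hX : IsHaarLSW P W lip C K w ξ X) {j : ℕ} (hj : 1 ≤ j)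
    (hjJ : j ≤ J) {l : ℝ} {t : ℤ} (ht : t ∈ windowTimes z l (2 ^ J)) {k : ℤ} (hk : k ∈ K (2 ^ J))
    (hkt : k ∈ Finset.Ico t (t + 2 ^ j)) :
    |w (2 ^ J) j k - W j z| ≤ (1 + |l|) / 2 ^ J * (C j + 2 ^ j * lip j) := by
  obtain ⟨_, _, h3⟩ := mem_windowTimes ht
  push_cast at h3
  have hT : (0 : ℝ) < 2 ^ J := by positivity
  have h4 := hX.amplitude J j hj hjJ k hk
  have hC : 0 ≤ C j := by
    have := (abs_nonneg _).trans h4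
    rwa [le_div_iff₀ hT, zero_mul] at this
  have h5 := (hX.lipschitz j hj).dist_le_mul ((k : ℝ) / 2 ^ J) z
  rw [Real.dist_eq, Real.dist_eq] at h5
  have h6 : |(k : ℝ) / 2 ^ J - t / 2 ^ J| ≤ 2 ^ j / 2 ^ J := by
    rw [← sub_div, abs_div, abs_of_pos hT]
    refine div_le_div_of_nonneg_right ?_ hT.le
    rw [Finset.mem_Ico] at hkt
    have h7 : (t : ℝ) ≤ k := by exact_mod_cast hkt.1
    have h8 : (k : ℝ) < t + 2 ^ j := by exact_mod_cast hkt.2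
    rw [abs_le]
    constructor <;> linarith
  have h7 : |(k : ℝ) / 2 ^ J - z| ≤ (2 ^ j + |l|) / 2 ^ J := by
    have h8 : l / (2 * 2 ^ J) ≤ |l| / 2 ^ J := by
      rw [div_le_div_iff₀ (by positivity) hT]
      nlinarith [le_abs_self l, abs_nonneg l]
    calc |(k : ℝ) / 2 ^ J - z| ≤ |(k : ℝ) / 2 ^ J - t / 2 ^ J| + |(t : ℝ) / 2 ^ J - z| :=
          abs_sub_le _ _ _
      _ ≤ 2 ^ j / 2 ^ J + |l| / 2 ^ J := add_le_add h6 (h3.trans h8)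
      _ = _ := by ring
  have h1j : (1 : ℝ) ≤ 2 ^ j := one_le_pow₀ (by norm_num)
  calc |w (2 ^ J) j k - W j z|
      ≤ |w (2 ^ J) j k - W j ((k : ℝ) / 2 ^ J)| + |W j ((k : ℝ) / 2 ^ J) - W j z| :=
        abs_sub_le _ _ _
    _ ≤ C j / 2 ^ J + lip j * ((2 ^ j + |l|) / 2 ^ J) :=
        add_le_add h4 (h5.trans (mul_le_mul_of_nonneg_left h7 (lip j).2))
    _ = (C j + lip j * (2 ^ j + |l|)) / 2 ^ J := by ring
    _ ≤ ((1 + |l|) * (C j + 2 ^ j * lip j)) / 2 ^ J := by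
        refine div_le_div_of_nonneg_right ?_ hT.le
        have e1 : 0 ≤ |l| * C j := mul_nonneg (abs_nonneg _) hC
        have e2 : 0 ≤ (lip j : ℝ) * |l| * (2 ^ j - 1) :=
          mul_nonneg (mul_nonneg (lip j).2 (abs_nonneg _)) (by linarith)
        nlinarith
    _ = _ := by ring

theorem IsHaarLSW.memLp (hX : IsHaarLSW P W lip C K w ξ X) {t : ℤ} (h0 : 0 ≤ t)
    (ht : t < 2 ^ J) : MemLp (X (2 ^ J) t) 2 P := by
  classical
  exact (memLp_congr_ae (hX.ae_eq_sum h0 ht)).2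
    (hX.isOrthonormalArray.memLp_sum one_le_of_mem_product fun p =>
      (if p.2 ∈ K (2 ^ J) then w (2 ^ J) p.1 p.2 else 0) * nondecimatedHaar p.1 p.2 t)

theorem IsHaarLSW.integral_eq_zero [IsFiniteMeasure P] (hX : IsHaarLSW P W lip C K w ξ X) {t : ℤ}
    (h0 : 0 ≤ t) (ht : t < 2 ^ J) : ∫ ω, X (2 ^ J) t ω ∂P = 0 := by
  classical
  rw [integral_congr_ae (hX.ae_eq_sum h0 ht)]
  exact hX.isOrthonormalArray.integral_sum one_le_of_mem_product fun p =>
    (if p.2 ∈ K (2 ^ J) then w (2 ^ J) p.1 p.2 else 0) * nondecimatedHaar p.1 p.2 t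

/-- The condition on t + 2^M keeps the locations of scales up to `M` inside 0, …, T - 1, hence in
`K`. At coarser scales locations may be missing from `K`, but there nothing is subtracted and the
whole contribution is bounded by the tail. -/
theorem IsHaarLSW.integral_sub_haarSum_sq_le (hX : IsHaarLSW P W lip C K w ξ X)
    (ha : Summable fun j => W j z ^ 2)
    (hD : Summable fun j => (C j + 2 ^ j * (lip j : ℝ)) ^ 2) (hMJ : M ≤ J) {l : ℝ} {t : ℤ}
    (ht : t ∈ windowTimes z l (2 ^ J)) (htM : t + 2 ^ M ≤ 2 ^ J) :
    ∫ ω, (X (2 ^ J) t ω - haarSum (fun j => W j z) ξ M t ω) ^ 2 ∂P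
      ≤ 2 * ((1 + |l|) / 2 ^ J) ^ 2 * ∑' j, (C j + 2 ^ j * (lip j : ℝ)) ^ 2
        + 2 * scaleTail (fun j => W j z) M := by
  classical
  obtain ⟨h0, h1, -⟩ := mem_windowTimes ht
  push_cast at h1
  set δ := (1 + |l|) / 2 ^ J
  set D : ℕ → ℝ := fun j => C j + 2 ^ j * (lip j : ℝ)
  have hint : ∫ ω, (X (2 ^ J) t ω - haarSum (fun j => W j z) ξ M t ω) ^ 2 ∂P
      = ∫ ω, (∑ p ∈ Finset.Icc 1 J ×ˢ Finset.Ico t (t + 2 ^ J),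
        ((if p.2 ∈ K (2 ^ J) then w (2 ^ J) p.1 p.2 else 0) - if p.1 ≤ M then W p.1 z else 0)
          * nondecimatedHaar p.1 p.2 t * ξ p.1 p.2 ω) ^ 2 ∂P := by
    refine integral_congr_ae ?_
    filter_upwards [hX.ae_eq_sum h0 h1] with ω hω
    rw [hω, haarSum_eq_of_le hMJ, ← Finset.sum_sub_distrib]
    congr 1
    exact Finset.sum_congr rfl fun p _ => by ring
  rw [hint]
  refine (integral_scale_sum_sq_le hX.isOrthonormalArray
    (e := fun j k => (if k ∈ K (2 ^ J) then w (2 ^ J) j k else 0) - if j ≤ M then W j z else 0)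
    (E := fun j => 2 * δ ^ 2 * D j ^ 2 + 2 * if M < j then W j z ^ 2 else 0)
    fun j hj hjJ k hk => ?_).trans ?_
  · have hsq : k ∈ K (2 ^ J) → (w (2 ^ J) j k - W j z) ^ 2 ≤ δ ^ 2 * D j ^ 2 := fun hkK => by
      rw [← mul_pow, ← sq_abs (w (2 ^ J) j k - W j z)]
      exact pow_le_pow_left₀ (abs_nonneg _) (hX.abs_amplitude_sub_le hj hjJ ht hkK hk) 2
    have hpos : 0 ≤ δ ^ 2 * D j ^ 2 := by positivity
    rcases le_or_gt j M with h | h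
    · have hkK : k ∈ K (2 ^ J) := by
        have h2 := Finset.mem_Ico.1 (Ico_scale_subset h t hk)
        exact hX.locations J k (by omega) (by omega)
      rw [if_pos hkK, if_pos h, if_neg (not_lt.2 h)]
      linarith [hsq hkK]
    · rw [if_neg (not_le.2 h), if_pos h]
      split_ifs with hkK
      -- This is w² ≤ 2(w - W)² + 2W², whose two sides differ by (w - 2W)².
      · nlinarith [hsq hkK, sq_nonneg (w (2 ^ J) j k - 2 * W j z)]
      · nlinarith [sq_nonneg (W j z)]
  · rw [Finset.sum_add_distrib, ← Finset.mul_sum, ← Finset.mul_sum, ← Finset.sum_filter]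
    refine add_le_add (mul_le_mul_of_nonneg_left ?_ (by positivity))
      (mul_le_mul_of_nonneg_left (sum_filter_lt_le_scaleTail ha hMJ) (by norm_num))
    exact hD.sum_le_tsum _ fun j _ => sq_nonneg _

theorem IsHaarLSW.isHaarApprox (hX : IsHaarLSW P W lip C K w ξ X)
    (ha : Summable fun j => W j z ^ 2)
    (hD : Summable fun j => (C j + 2 ^ j * (lip j : ℝ)) ^ 2)
    (hLT : Tendsto (fun T : ℕ => L T / T) atTop (𝓝 0)) (hz : z ∈ Set.Ioo (0 : ℝ) 1) :
    IsHaarApprox P (fun j => W j z) ξ (fun J => windowTimes z (L (2 ^ J)) (2 ^ J))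
      fun J => X (2 ^ J) where
  memLp J t ht := by
    obtain ⟨h0, h1, -⟩ := mem_windowTimes ht
    exact hX.memLp h0 (by exact_mod_cast h1)
  approx ε hε := by
    have hinv : Tendsto (fun J : ℕ => ((2 : ℝ) ^ J)⁻¹) atTop (𝓝 0) :=
      tendsto_inv_atTop_zero.comp (tendsto_pow_atTop_atTop_of_one_lt (by norm_num))
    have hLT2 : Tendsto (fun J : ℕ => L (2 ^ J) / 2 ^ J) atTop (𝓝 0) := by
      have := hLT.comp tendsto_two_pow_atTop
      simpa [Function.comp_def] using this
    have hδ : Tendsto (fun J : ℕ => (1 + |L (2 ^ J)|) / (2 : ℝ) ^ J) atTop (𝓝 0) := by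
      have := hinv.add hLT2.abs
      simp only [abs_zero, add_zero] at this
      refine this.congr fun J => ?_
      rw [abs_div, abs_of_pos (show (0 : ℝ) < 2 ^ J by positivity)]
      ring
    have hmain := ((hδ.pow 2).const_mul 2).mul_const (∑' j, (C j + 2 ^ j * (lip j : ℝ)) ^ 2)
    simp only [ne_eq, OfNat.ofNat_ne_zero, not_false_eq_true, zero_pow, mul_zero, zero_mul] at hmain
    filter_upwards [(tendsto_scaleTail fun j => W j z).eventually_le_const
      (show 0 < ε / 4 by positivity)] with M hM
    -- Since z < 1, wavelets of the scales up to a fixed `M` that start in the window eventually end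
    -- before T.
    have hroom : Tendsto (fun J : ℕ => z + L (2 ^ J) / 2 ^ J / 2 + 2 ^ M * ((2 : ℝ) ^ J)⁻¹) atTop
        (𝓝 z) := by
      simpa using ((hLT2.div_const 2).const_add z).add (hinv.const_mul (2 ^ M))
    filter_upwards [eventually_ge_atTop M, hmain.eventually_le_const (half_pos hε),
      hroom.eventually_lt_const hz.2] with J hJ hJ1 hJ2 t ht
    refine (hX.integral_sub_haarSum_sq_le ha hD hJ ht ?_).trans (by linarith)
    obtain ⟨-, -, h3⟩ := mem_windowTimes ht
    have h4 := (abs_le.1 h3).2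
    push_cast at h4
    have hT : (0 : ℝ) < 2 ^ J := by positivity
    have h5 : (t : ℝ) / 2 ^ J + 2 ^ M / 2 ^ J < 1 := by
      have e1 : L (2 ^ J) / (2 * 2 ^ J) = L (2 ^ J) / 2 ^ J / 2 := by
        rw [div_div, mul_comm]
      rw [div_eq_mul_inv (2 ^ M : ℝ)]
      linarith
    rw [← add_div, div_lt_one hT] at h5
    have h6 : t + 2 ^ M < 2 ^ J := by exact_mod_cast h5
    exact h6.le

end

/-! ### Continuity of the Yule–Walker map and consistency of the estimator. -/

noncomputable section

/-- The Toeplitz matrix of the Yule–Walker equations for the autocovariances `v`. -/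
def yuleWalkerMatrix (τ : ℕ) (v : ℕ → ℝ) : Matrix (Fin τ) (Fin τ) ℝ :=
  Matrix.of fun i j => v ((i : ℤ) - (j : ℤ)).natAbs

/-- The partial autocorrelation at lag `τ` obtained from the autocovariances `v`. -/
def pacfOfAutocov (τ : ℕ) (hτ : 0 < τ) (v : ℕ → ℝ) : ℝ :=
  ((yuleWalkerMatrix τ v)⁻¹ *ᵥ fun i : Fin τ => v ((i : ℕ) + 1)) ⟨τ - 1, by omega⟩

theorem samplePacf_eq {τ : ℕ} (hτ : 0 < τ) (A : Finset ℤ) (x : ℤ → ℝ) :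
    samplePacf A x τ = pacfOfAutocov τ hτ (sampleAutocov A x) := by
  rw [samplePacf, dif_pos hτ]
  rfl

theorem continuous_yuleWalkerMatrix (τ : ℕ) : Continuous (yuleWalkerMatrix τ) :=
  continuous_matrix fun _ _ => continuous_apply _

/-- Cramer's rule exhibits a quotient of polynomials in the autocovariances, from which
measurability everywhere and continuity off the singular set follow. The convention 0⁻¹ = 0 gives
the value 0 for singular matrices. -/
theorem pacfOfAutocov_eq {τ : ℕ} (hτ : 0 < τ) (v : ℕ → ℝ) :
    pacfOfAutocov τ hτ v = (yuleWalkerMatrix τ v).det⁻¹ *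
      ((yuleWalkerMatrix τ v).adjugate *ᵥ fun i : Fin τ => v ((i : ℕ) + 1)) ⟨τ - 1, by omega⟩ := by
  rw [pacfOfAutocov, Matrix.inv_def, Ring.inverse_eq_inv', Matrix.smul_mulVec, Pi.smul_apply,
    smul_eq_mul]

theorem continuous_adjugate_mulVec {τ : ℕ} (i : Fin τ) : Continuous fun v : ℕ → ℝ =>
    ((yuleWalkerMatrix τ v).adjugate *ᵥ fun i : Fin τ => v ((i : ℕ) + 1)) i :=
  (continuous_apply i).comp ((continuous_yuleWalkerMatrix τ).matrix_adjugate.matrix_mulVec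
    (continuous_pi fun _ => continuous_apply _))

theorem measurable_pacfOfAutocov {τ : ℕ} (hτ : 0 < τ) : Measurable (pacfOfAutocov τ hτ) := by
  have : pacfOfAutocov τ hτ = fun v => _ := funext (pacfOfAutocov_eq hτ)
  rw [this]
  exact (continuous_yuleWalkerMatrix τ).matrix_det.measurable.inv.mul
    (continuous_adjugate_mulVec _).measurable

theorem continuousAt_pacfOfAutocov {τ : ℕ} (hτ : 0 < τ) {v : ℕ → ℝ}
    (hv : (yuleWalkerMatrix τ v).det ≠ 0) : ContinuousAt (pacfOfAutocov τ hτ) v := by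
  have : pacfOfAutocov τ hτ = fun v => _ := funext (pacfOfAutocov_eq hτ)
  rw [this]
  exact ((continuous_yuleWalkerMatrix τ).matrix_det.continuousAt.inv₀ hv).mul
    (continuous_adjugate_mulVec _).continuousAt

/-- A kernel vector would make the positive quadratic form of `haarAutocov_quadratic_pos` vanish. -/
theorem yuleWalkerMatrix_haarAutocov_det_ne_zero {a : ℕ → ℝ} (ha : Summable fun j => a j ^ 2)
    (hne : ∃ j, 1 ≤ j ∧ a j ≠ 0) (τ : ℕ) :
    (yuleWalkerMatrix τ fun h => haarAutocov a h).det ≠ 0 := by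
  intro hdet
  obtain ⟨v, hv, hMv⟩ := Matrix.exists_mulVec_eq_zero_iff.2 hdet
  have hpos := haarAutocov_quadratic_pos ha hne v hv
  have : ∑ i, ∑ l, v i * v l * haarAutocov a ((i : ℤ) - (l : ℤ))
      = ∑ i, v i * (yuleWalkerMatrix τ (fun h => haarAutocov a h) *ᵥ v) i := by
    refine Finset.sum_congr rfl fun i _ => ?_
    rw [Matrix.mulVec, dotProduct, Finset.mul_sum]
    refine Finset.sum_congr rfl fun l _ => ?_
    rw [yuleWalkerMatrix, Matrix.of_apply, haarAutocov_natAbs]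
    ring
  rw [this, hMv] at hpos
  simp at hpos

variable {Ω : Type*} [MeasurableSpace Ω] {P : Measure Ω}

/-- Convergence in mean of all coordinates to constants passes to bounded functionals that are
continuous at the limit. -/
theorem tendsto_integral_of_continuousAt [IsProbabilityMeasure P] {g : ℕ → ℕ → Ω → ℝ} {c : ℕ → ℝ}
    (hg : ∀ n i, Integrable (g n i) P)
    (hlim : ∀ i, Tendsto (fun n => ∫ ω, |g n i ω - c i| ∂P) atTop (𝓝 0))
    {Φ : (ℕ → ℝ) → ℝ} (hΦm : Measurable Φ) {B : ℝ} (hB : ∀ v, |Φ v| ≤ B)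
    (hΦ : ContinuousAt Φ c) :
    Tendsto (fun n => ∫ ω, Φ (fun i => g n i ω) ∂P) atTop (𝓝 (Φ c)) := by
  have hB0 : 0 ≤ B := (abs_nonneg _).trans (hB 0)
  have hgm : ∀ n, AEMeasurable (fun ω i => g n i ω) P := fun n =>
    aemeasurable_pi_lambda _ fun i => (hg n i).aestronglyMeasurable.aemeasurable
  have hΦi : ∀ n, Integrable (fun ω => Φ fun i => g n i ω) P := fun n =>
    Integrable.of_bound (hΦm.comp_aemeasurable (hgm n)).aestronglyMeasurable B
      (Eventually.of_forall fun ω => hB _)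
  rw [Metric.tendsto_nhds]
  intro ε hε
  have hnhds := hΦ.preimage_mem_nhds (Metric.ball_mem_nhds (Φ c) (half_pos hε))
  -- Continuity in the product topology constrains finitely many coordinates only, which are
  -- collected in `I`.
  rw [nhds_pi, Filter.mem_pi] at hnhds
  obtain ⟨I, hI, s, hs, hsub⟩ := hnhds
  choose δ hδ hball using fun i => Metric.mem_nhds_iff.1 (hs i)
  -- Markov's inequality in pointwise form: if some coordinate is off by at least δ i, its term
  -- alone is at least 2B, the largest possible difference of values of Φ.
  have hpt : ∀ v : ℕ → ℝ, |Φ v - Φ c| ≤ ε / 2 + ∑ i ∈ hI.toFinset, 2 * B / δ i * |v i - c i| := by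
    intro v
    have hterm : ∀ i, 0 ≤ 2 * B / δ i * |v i - c i| := fun i =>
      mul_nonneg (div_nonneg (by linarith) (hδ i).le) (abs_nonneg _)
    by_cases hv : ∀ i ∈ I, |v i - c i| < δ i
    · have : v ∈ Φ ⁻¹' Metric.ball (Φ c) (ε / 2) := hsub fun i hi => hball i (by
        rw [Metric.mem_ball, Real.dist_eq]; exact hv i hi)
      rw [Set.mem_preimage, Metric.mem_ball, Real.dist_eq] at this
      linarith [Finset.sum_nonneg fun i (_ : i ∈ hI.toFinset) => hterm i]
    · push Not at hv
      obtain ⟨i, hi, hvi⟩ := hv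
      have h1 : 2 * B ≤ 2 * B / δ i * |v i - c i| := by
        rw [div_mul_eq_mul_div, le_div_iff₀ (hδ i)]
        exact mul_le_mul_of_nonneg_left hvi (by linarith)
      have h2 := Finset.single_le_sum (f := fun i => 2 * B / δ i * |v i - c i|)
        (fun i _ => hterm i) (hI.mem_toFinset.2 hi)
      have h3 := (abs_sub (Φ v) (Φ c)).trans (add_le_add (hB v) (hB c))
      linarith
  have hlim2 : Tendsto (fun n => ∑ i ∈ hI.toFinset, 2 * B / δ i * ∫ ω, |g n i ω - c i| ∂P) atTop
      (𝓝 0) := by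
    have : Tendsto (fun n => ∑ i ∈ hI.toFinset, 2 * B / δ i * ∫ ω, |g n i ω - c i| ∂P) atTop
        (𝓝 (∑ i ∈ hI.toFinset, 2 * B / δ i * 0)) := by
      refine tendsto_finsetSum _ fun i _ => ?_
      exact (hlim i).const_mul _
    simpa using this
  filter_upwards [hlim2.eventually_lt_const (half_pos hε)] with n hn
  have hi : ∀ i ∈ hI.toFinset, Integrable (fun ω => 2 * B / δ i * |g n i ω - c i|) P := fun i _ =>
    ((hg n i).sub (integrable_const _)).abs.const_mul _
  have h1 : ∫ ω, Φ (fun i => g n i ω) ∂P - Φ c = ∫ ω, (Φ (fun i => g n i ω) - Φ c) ∂P := by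
    rw [integral_sub (hΦi n) (integrable_const _)]
    simp
  rw [Real.dist_eq, h1]
  calc |∫ ω, (Φ (fun i => g n i ω) - Φ c) ∂P|
      ≤ ∫ ω, |Φ (fun i => g n i ω) - Φ c| ∂P := abs_integral_le_integral_abs
    _ ≤ ∫ ω, (ε / 2 + ∑ i ∈ hI.toFinset, 2 * B / δ i * |g n i ω - c i|) ∂P :=
        integral_mono ((hΦi n).sub (integrable_const _)).abs
          ((integrable_const _).add (integrable_finsetSum _ hi)) fun ω => hpt _
    _ = ε / 2 + ∑ i ∈ hI.toFinset, 2 * B / δ i * ∫ ω, |g n i ω - c i| ∂P := by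
        rw [integral_add (integrable_const _) (integrable_finsetSum _ hi), integral_finsetSum _ hi]
        simp only [integral_const_mul]
        simp
    _ < ε := by linarith

theorem integrable_sampleAutocov {A : Finset ℤ} {Z : ℤ → Ω → ℝ} (hZ : ∀ t ∈ A, MemLp (Z t) 2 P)
    (h : ℕ) : Integrable (fun ω => sampleAutocov A (fun t => Z t ω) h) P := by
  refine (integrable_finsetSum _ fun t ht => ?_).div_const _
  have hm := memLp_sampleMean hZ
  exact ((hZ _ (Finset.mem_filter.1 ht).2).sub hm).integrable_mul
    ((hZ _ (Finset.mem_filter.1 ht).1).sub hm)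

theorem aemeasurable_samplePacf {A : Finset ℤ} {Z : ℤ → Ω → ℝ} (hZ : ∀ t ∈ A, MemLp (Z t) 2 P)
    {τ : ℕ} (hτ : 0 < τ) : AEMeasurable (fun ω => samplePacf A (fun t => Z t ω) τ) P := by
  simp only [samplePacf_eq hτ]
  exact (measurable_pacfOfAutocov hτ).comp_aemeasurable (aemeasurable_pi_lambda _ fun h =>
    (integrable_sampleAutocov hZ h).aestronglyMeasurable.aemeasurable)

/-- Consistency of the Yule–Walker estimator when the sample autocovariances converge in mean to
those of a Haar process. -/
theorem tendsto_integral_samplePacf [IsProbabilityMeasure P] {a : ℕ → ℝ}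
    (ha : Summable fun j => a j ^ 2) (hne : ∃ j, 1 ≤ j ∧ a j ≠ 0) {A : ℕ → Finset ℤ}
    {Z : ℕ → ℤ → Ω → ℝ} (hZ : ∀ J, ∀ t ∈ A J, MemLp (Z J t) 2 P)
    (hlim : ∀ h : ℕ, Tendsto (fun J => ∫ ω, |sampleAutocov (A J) (fun t => Z J t ω) h
      - haarAutocov a h| ∂P) atTop (𝓝 0)) {τ : ℕ} (hτ : 0 < τ) (f : ℝ →ᵇ ℝ) :
    Tendsto (fun J => ∫ ω, f (samplePacf (A J) (fun t => Z J t ω) τ) ∂P) atTop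
      (𝓝 (f (pacfOfAutocov τ hτ fun h => haarAutocov a h))) := by
  simp only [samplePacf_eq hτ]
  exact tendsto_integral_of_continuousAt (Φ := fun v => f (pacfOfAutocov τ hτ v))
    (fun J h => integrable_sampleAutocov (hZ J) h) hlim
    (f.continuous.measurable.comp (measurable_pacfOfAutocov hτ)) (fun v => f.norm_coe_le_norm _)
    (f.continuous.continuousAt.comp (continuousAt_pacfOfAutocov hτ
      (yuleWalkerMatrix_haarAutocov_det_ne_zero ha hne τ)))

end

/-! ### The common limit of the two estimators. -/

theorem proposition4
    {Ω : Type*} [MeasurableSpace Ω] (P : Measure Ω) [IsProbabilityMeasure P]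
    (W : ℕ → ℝ → ℝ) (lip : ℕ → ℝ≥0) (C : ℕ → ℝ) (K : ℕ → Set ℤ)
    (w : ℕ → ℕ → ℤ → ℝ) (ξ : ℕ → ℤ → Ω → ℝ) (X : ℕ → ℤ → Ω → ℝ)
    (hX : IsHaarLSW P W lip C K w ξ X) (hGauss : IsGaussianArray P X)
    (hC : Summable fun j => C j ^ 2 * 2 ^ (2 * j))
    (hlip : Summable fun j => (lip j : ℝ) ^ 2 * 2 ^ (2 * j))
    (hW : ∀ u ∈ Set.Ioo (0 : ℝ) 1, Summable fun j => W j u ^ 2 * 2 ^ (2 * j))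
    (L : ℕ → ℝ) (hL : Tendsto L atTop atTop)
    (hLT : Tendsto (fun T : ℕ => L T / T) atTop (𝓝 0))
    (z : ℝ) (hz : z ∈ Set.Ioo (0 : ℝ) 1) (hWz : ∃ j, 1 ≤ j ∧ W j z ≠ 0)
    {Ω' : Type*} [MeasurableSpace Ω'] (P' : Measure Ω') [IsProbabilityMeasure P']
    (ξ' : ℕ → ℤ → Ω' → ℝ) (Y : ℤ → Ω' → ℝ)
    (hY : IsStationaryHaar P' (fun j => W j z) ξ' Y)
    (τ : ℕ) (hτ : 1 ≤ τ) :
    ConvergesInLawTo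
      (fun J ω => samplePacf (windowTimes z (L (2 ^ J)) (2 ^ J)) (fun t => X (2 ^ J) t ω) τ) P
      (fun J ω => samplePacf (windowTimes z (L (2 ^ J)) (2 ^ J)) (fun t => Y t ω) τ) P' := by
  have hpow : ∀ j : ℕ, (1 : ℝ) ≤ 2 ^ (2 * j) := fun j => one_le_pow₀ (by norm_num)
  have ha : Summable fun j => W j z ^ 2 :=
    Summable.of_nonneg_of_le (fun _ => sq_nonneg _)
      (fun j => le_mul_of_one_le_right (sq_nonneg _) (hpow j)) (hW z hz)
  have hD : Summable fun j => (C j + 2 ^ j * (lip j : ℝ)) ^ 2 := by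
    refine Summable.of_nonneg_of_le (fun _ => sq_nonneg _) (fun j => ?_)
      ((hC.mul_left 2).add (hlip.mul_left 2))
    have h1 : C j ^ 2 ≤ C j ^ 2 * 2 ^ (2 * j) := le_mul_of_one_le_right (sq_nonneg _) (hpow j)
    have h2 : (lip j : ℝ) ^ 2 * 2 ^ (2 * j) = (2 ^ j * (lip j : ℝ)) ^ 2 := by
      rw [mul_pow, ← pow_mul, mul_comm j 2, mul_comm]
    rw [h2]
    nlinarith [sq_nonneg (C j - 2 ^ j * (lip j : ℝ))]
  have hcard := (tendsto_card_windowTimes hL hLT hz).comp tendsto_two_pow_atTop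
  have hwin : ∀ᶠ J : ℕ in atTop, ∃ b c,
      windowTimes z (L (2 ^ J)) (2 ^ J) = Finset.Icc b c :=
    (tendsto_two_pow_atTop.eventually (eventually_windowTimes_eq_Icc hL hLT hz)).mono
      fun J hJ => ⟨_, _, hJ⟩
  have hτ' : 0 < τ := hτ
  have hrange : ∀ J : ℕ, ∀ t ∈ windowTimes z (L (2 ^ J)) (2 ^ J), 0 ≤ t ∧ t < 2 ^ J :=
    fun J t ht => ⟨(mem_windowTimes ht).1, by exact_mod_cast (mem_windowTimes ht).2.1⟩
  have hξX := hX.isOrthonormalArray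
  have hapX := hX.isHaarApprox ha hD hLT hz
  have hξY := hY.isOrthonormalArray
  have hapY := hY.isHaarApprox ha fun J => windowTimes z (L (2 ^ J)) (2 ^ J)
  refine ⟨fun J => aemeasurable_samplePacf (hapX.memLp J) hτ',
    fun J => aemeasurable_samplePacf (hapY.memLp J) hτ', fun f => ?_⟩
  -- For X the law of large numbers rests on Gaussianity, as its increments are merely orthonormal.
  have hlimX := tendsto_integral_samplePacf ha hWz hapX.memLp (fun h =>
    tendsto_integral_abs_sampleAutocov_sub hcard hapX.memLp (hapX.isWeaklyCorrelated hξX ha) h _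
      (tendsto_integral_abs_lagged_products_gaussian hcard hwin
        (fun J => (hGauss J).comp_right fun t : windowTimes z (L (2 ^ J)) (2 ^ J) =>
          (⟨t.1, hrange J t.1 t.2⟩ : Set.Ico (0 : ℤ) (2 ^ J)))
        (fun J t ht => hX.integral_eq_zero (hrange J t ht).1 (hrange J t ht).2)
        (hapX.isWeaklyCorrelated hξX ha) h fun ε hε => by
          filter_upwards [hapX.abs_cov_sub_le hξX ha hε] with J hJ t ht hth
          have := hJ _ hth _ ht
          rwa [sub_add_cancel_left, haarAutocov_neg] at this)) hτ' f
  -- For Y it rests on independent, identically distributed increments. The limit is the same as for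
  -- X.
  have hlimY := tendsto_integral_samplePacf ha hWz hapY.memLp (fun h =>
    tendsto_integral_abs_sampleAutocov_sub hcard hapY.memLp (hapY.isWeaklyCorrelated hξY ha) h _
      (tendsto_integral_abs_lagged_products_indep hcard hwin hξY ha hY.indep hY.identDistrib
        hapY h)) hτ' f
  simpa using hlimX.sub hlimY
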